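/- Setting. Let $\mathbf U(\theta)=U_M(\theta_M)\cdots U_1(\theta_1)$ be a parametrized circuit on $N$ qubits with gates $U_\nu(\theta_\nu)=e^{-i\theta_\nu\Omega_\nu}$, $\Omega_\nu$ Hermitian, and let the gates be grouped consecutively into blocks, $\mathbf U=B_{K}\cdots B_1$. The support $s(B_k)$ is the set of qubits on which the gates of $B_k$ act non-trivially. Let $H=\sum_j\lambda_jh_j$ be a Hamiltonian with real coefficients $\lambda_j\ne0$ and distinct Pauli strings $h_j$, such that every qubit in the support of some $h_j$ lies in some $s(B_k)$, and let $C(\theta)=\operatorname{tr}(\rho_0\mathbf U(\theta)^\dagger H\,\mathbf U(\theta))$ with $\rho_0=|0\cdots0\rangle\langle0\cdots0|$. Fix a gate $U_\mu$ (the differential gate) whose generator $\Omega_\mu$ is a Pauli string other than the identity, let $B_{k(\mu)}$ be the block containing it (the differential block), and write $B_{k(\mu)}=R\,U_\mu L$, where $L$ and $R$ are the products of the gates of that block before and after $U_\mu$. The parameters $\theta$ are random, with a law for which the random unitaries $B_k$ ($k\neq k(\mu)$), $L$, $U_\mu$, $R$ are mutually independent, each $B_k$ with $k\ne k(\mu)$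 is a unitary $2$-design on $s(B_k)$, and both $L$ and $R$ are unitary $2$-designs on $s(B_{k(\mu)})$. Let $r$ be the maximum of the support sizes of the $h_j$, $\beta=\max_k|s(B_k)|$ the maximum block size, and $\chi$ the maximum over the qubits $q$ of the local depth, i.e. of the number of blocks $B_k$ with $q\in s(B_k)$. Theorem. The variance of $\partial_\mu C=\partial C/\partial\theta_\mu$ over the random parameters satisfies $$\operatorname{Var}[\partial_\mu C]\;\ge\;4^{-r\chi\beta}\sum_j 2\lambda_j^2,$$ where $j$ runs over the indices for which $h_j$ acts non-trivially on $s(B_{k(\mu)})$. Consequently, circuits of finite local depth have no barren plateaus: consider a sequence of such settings whose numbers of qubits $N_n$ tend to infinity, whose maximum interaction ranges, maximum local depths and maximum block sizes are bounded by constants $r,\chi,\beta$, and for which the sum of $\lambda_j^2$ over the terms non-trivial on the support of the differential block is at least a constant $c>0$. Then $\operatorname{Var}[\partial_\mu C]\ge 2c\,4^{-r\chi\beta}$ for every member of the sequence; in particular the variance does not vanish exponentially, i.e. there is no $b>1$ with $\operatorname{Var}[\partial_\mu C]=O(b^{-N_n})$. -/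

import Mathlib

open MeasureTheory ProbabilityTheory

/-! ### Unitary designs -/

/-- The product (Borel) measurable structure on complex matrices. -/
noncomputable instance instMeasurableSpaceComplexMatrix (m n : Type*) : MeasurableSpace (Matrix m n ℂ) :=
  inferInstanceAs (MeasurableSpace (m → n → ℂ))

/-- The Borel measurable structure on the unitary group. -/
noncomputable instance instMeasurableSpaceUnitaryGroup (d : Type*) [Fintype d] [DecidableEq d] :
    MeasurableSpace (Matrix.unitaryGroup d ℂ) := borel _

instance instBorelSpaceUnitaryGroup (d : Type*) [Fintype d] [DecidableEq d] :
    BorelSpace (Matrix.unitaryGroup d ℂ) := ⟨rfl⟩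

/-- The unitary group is compact. -/
instance instCompactSpaceUnitaryGroup (d : Type*) [Fintype d] [DecidableEq d] :
    CompactSpace (Matrix.unitaryGroup d ℂ) := by
  apply isCompact_iff_compactSpace.mp
  have hc : IsCompact
      (Set.pi Set.univ fun _ : d => Set.pi Set.univ fun _ : d => Metric.closedBall (0 : ℂ) 1) :=
    isCompact_univ_pi fun _ => isCompact_univ_pi fun _ => isCompact_closedBall 0 1
  refine hc.of_isClosed_subset (?_ : IsClosed ((Matrix.unitaryGroup d ℂ : Set (Matrix d d ℂ)))) ?_
  · have : ((Matrix.unitaryGroup d ℂ : Submonoid (Matrix d d ℂ)) : Set (Matrix d d ℂ))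
        = {A | star A * A = 1} ∩ {A | A * star A = 1} := by
      ext A
      exact Unitary.mem_iff
    rw [this]
    exact (isClosed_eq (by fun_prop) continuous_const).inter
      (isClosed_eq (by fun_prop) continuous_const)
  · intro A hA i _ j _
    simpa using entry_norm_bound_of_unitary hA i j

/-- The normalized Haar measure on the unitary group. -/
noncomputable def haarUnitary (d : Type*) [Fintype d] [DecidableEq d] :
    Measure (Matrix.unitaryGroup d ℂ) :=
  Measure.haarMeasure (⊤ : TopologicalSpace.PositiveCompacts (Matrix.unitaryGroup d ℂ))

/-- The random unitary `V` is a unitary `t`-design: every monomial of degree `t` in the entries of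
`V` and degree `t` in the entries of `V†` has the same average as under the Haar measure. -/
def IsUnitaryDesign {Ω d : Type*} [MeasurableSpace Ω] [Fintype d] [DecidableEq d] (t : ℕ)
    (P : Measure Ω) (V : Ω → Matrix.unitaryGroup d ℂ) : Prop :=
  ∀ i j k l : Fin t → d,
    ∫ ω, ∏ a, ((V ω : Matrix d d ℂ) (i a) (j a) *
        (V ω : Matrix d d ℂ).conjTranspose (k a) (l a)) ∂P =
      ∫ W, ∏ a, ((W : Matrix d d ℂ) (i a) (j a) *
        (W : Matrix d d ℂ).conjTranspose (k a) (l a)) ∂(haarUnitary d)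

/-! ### Operators on `N` qubits -/

/-- Operators on `N` qubits, as matrices in the computational basis. -/
abbrev QOp (N : ℕ) := Matrix (Fin N → Fin 2) (Fin N → Fin 2) ℂ

/-- The operator `V ⊗ I`, with `V` acting on the qubits in `s` and `I` on the other ones. -/
def embedOp {N : ℕ} (s : Finset (Fin N)) (V : Matrix (s → Fin 2) (s → Fin 2) ℂ) : QOp N :=
  Matrix.of fun x y =>
    if ∀ i, i ∉ s → x i = y i then V (fun i => x i) (fun i => y i) else 0

open Classical in
/-- The support of an operator: the qubits on which it acts non-trivially, that is, the qubits `q`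
for which the operator is not of the form `V ⊗ I_q`. -/
noncomputable def opSupport {N : ℕ} (A : QOp N) : Finset (Fin N) :=
  Finset.univ.filter fun q => ¬ ∃ V, A = embedOp (Finset.univ.erase q) V

/-- The random `N`-qubit operator `B` is a local `t`-design on the qubits in `s`. -/
def IsLocalDesign {Ω : Type*} [MeasurableSpace Ω] {N : ℕ} (t : ℕ) (P : Measure Ω)
    (s : Finset (Fin N)) (B : Ω → QOp N) : Prop :=
  ∃ V : Ω → Matrix.unitaryGroup (s → Fin 2) ℂ,
    Measurable V ∧ (∀ ω, B ω = embedOp s (V ω)) ∧ IsUnitaryDesign t P V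

/-! ### Pauli strings -/

/-- The labels of the four Pauli matrices. -/
inductive Pauli
  | I | X | Y | Z
  deriving DecidableEq

instance : Fintype Pauli := ⟨{.I, .X, .Y, .Z}, by intro x; cases x <;> decide⟩

/-- The Pauli matrices. -/
def Pauli.toMatrix : Pauli → Matrix (Fin 2) (Fin 2) ℂ
  | .I => 1
  | .X => !![0, 1; 1, 0]
  | .Y => !![0, -Complex.I; Complex.I, 0]
  | .Z => !![1, 0; 0, -1]

/-- Pauli strings on `N` qubits. -/
abbrev PauliString (N : ℕ) := Fin N → Pauli

namespace PauliString

/-- The tensor product of the Pauli matrices in the string. -/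
noncomputable def toOp {N : ℕ} (h : PauliString N) : QOp N :=
  Matrix.of fun x y => ∏ i, (h i).toMatrix (x i) (y i)

/-- The qubits on which the string is not the identity. -/
def support {N : ℕ} (h : PauliString N) : Finset (Fin N) :=
  Finset.univ.filter fun i => h i ≠ Pauli.I

end PauliString

/-! ### Variational quantum eigensolvers with randomly initialized blocks -/

/-- The data of a variational quantum eigensolver. The circuit is `U_M(θ_M) ⋯ U_1(θ_1)` with
`U_ν(θ_ν) = exp(-i θ_ν Ω_ν)`, and its gates are grouped into consecutive blocks. -/
structure VQE where
  /-- the number of qubits -/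
  numQubits : ℕ
  /-- the number of gates, which is the number of parameters -/
  numGates : ℕ
  /-- the number of blocks -/
  numBlocks : ℕ
  /-- the generators `Ω_ν` of the gates -/
  gen : Fin numGates → QOp numQubits
  gen_isHermitian : ∀ ν, (gen ν).IsHermitian
  /-- the index of the block to which a gate belongs -/
  block : Fin numGates → Fin numBlocks
  block_mono : Monotone block
  /-- the joint law of the randomly initialized parameters -/
  law : Measure (Fin numGates → ℝ)
  law_isProbability : IsProbabilityMeasure law
  /-- the index `μ` of the differential gate -/
  diffGate : Fin numGates
  /-- the coefficients `λ_h` in the Pauli decomposition `H = ∑ λ_h h` of the Hamiltonian -/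
  coeff : PauliString numQubits → ℝ

namespace VQE

variable (V : VQE)

/-- The gate `U_ν(t) = exp(-i t Ω_ν)`. -/
noncomputable def gate (ν : Fin V.numGates) (t : ℝ) : QOp V.numQubits :=
  NormedSpace.exp ((-(Complex.I * (t : ℂ))) • V.gen ν)

/-- The ordered product of the gates whose index is in `S`; later gates stand on the left. -/
noncomputable def gateProd (S : Finset (Fin V.numGates)) (θ : Fin V.numGates → ℝ) :
    QOp V.numQubits :=
  (((List.finRange V.numGates).reverse.filter (· ∈ S)).map fun ν => V.gate ν (θ ν)).prod

/-- The whole circuit. -/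
noncomputable def circuit (θ : Fin V.numGates → ℝ) : QOp V.numQubits :=
  V.gateProd Finset.univ θ

/-- The initial state `|0⋯0⟩⟨0⋯0|`. -/
def initialState : QOp V.numQubits := Matrix.single 0 0 1

/-- The Hamiltonian. -/
noncomputable def hamiltonian : QOp V.numQubits := ∑ h, (V.coeff h : ℂ) • h.toOp

/-- The cost function `C(θ) = tr(ρ₀ U† H U)`. -/
noncomputable def cost (θ : Fin V.numGates → ℝ) : ℝ :=
  (Matrix.trace (V.initialState * (V.circuit θ).conjTranspose * V.hamiltonian * V.circuit θ)).re

/-- The partial derivative of the cost function in the differential parameter. -/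
noncomputable def costDeriv (θ : Fin V.numGates → ℝ) : ℝ :=
  deriv (fun t => V.cost (Function.update θ V.diffGate t)) (θ V.diffGate)

/-- The variance of the cost derivative over the circuit ensemble. -/
noncomputable def gradVariance : ℝ := variance V.costDeriv V.law

/-- The Pauli terms of the Hamiltonian. -/
noncomputable def terms : Finset (PauliString V.numQubits) :=
  Finset.univ.filter fun h => V.coeff h ≠ 0

/-- The maximum interaction range of the Hamiltonian. -/
noncomputable def interactionRange : ℕ := V.terms.sup fun h => h.support.card

/-- The support of a block: the qubits on which the gates in the block act. -/
noncomputable def blockSupport (k : Fin V.numBlocks) : Finset (Fin V.numQubits) :=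
  (Finset.univ.filter fun ν => V.block ν = k).biUnion fun ν => opSupport (V.gen ν)

/-- The differential block. -/
def diffBlock : Fin V.numBlocks := V.block V.diffGate

/-- The maximum block size. -/
noncomputable def maxBlockSize : ℕ := Finset.univ.sup fun k => (V.blockSupport k).card

/-- The local depth at a qubit: the number of blocks acting on it. -/
noncomputable def localDepth (q : Fin V.numQubits) : ℕ :=
  (Finset.univ.filter fun k => q ∈ V.blockSupport k).card

/-- The maximum local depth. -/
noncomputable def maxLocalDepth : ℕ := Finset.univ.sup V.localDepth

/-- The Pauli terms of the Hamiltonian that are non-trivial on the support of the differential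
block. -/
noncomputable def relevantTerms : Finset (PauliString V.numQubits) :=
  V.terms.filter fun h => (h.support ∩ V.blockSupport V.diffBlock).Nonempty

/-- The segments of the circuit: the blocks other than the differential one, and the three parts of
the differential block `R U_μ L`. -/
inductive Segment (K : ℕ) (k₀ : Fin K)
  | block (k : Fin K) (hk : k ≠ k₀)
  | left
  | diff
  | right

/-- The gates in a segment. The sub-block `L` consists of the gates of the differential block before
the differential gate, `R` of those after it. -/
def segmentGates : Segment V.numBlocks V.diffBlock → Finset (Fin V.numGates)
  | .block k _ => Finset.univ.filter fun ν => V.block ν = k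
  | .left => Finset.univ.filter fun ν => V.block ν = V.diffBlock ∧ ν < V.diffGate
  | .diff => {V.diffGate}
  | .right => Finset.univ.filter fun ν => V.block ν = V.diffBlock ∧ V.diffGate < ν

/-- The random unitary of a segment. -/
noncomputable def segmentUnitary (σ : Segment V.numBlocks V.diffBlock)
    (θ : Fin V.numGates → ℝ) : QOp V.numQubits :=
  V.gateProd (V.segmentGates σ) θ

/-- The standing assumptions: the blocks are independent local `2`-designs, the differential gate is
generated by a (non-identity) Pauli string and is sandwiched, inside its block, by two independent
local `2`-designs on the support of the block, and the circuit covers the Hamiltonian. -/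
structure Assumptions : Prop where
  block_design : ∀ k (hk : k ≠ V.diffBlock),
    IsLocalDesign 2 V.law (V.blockSupport k) (V.segmentUnitary (.block k hk))
  left_design : IsLocalDesign 2 V.law (V.blockSupport V.diffBlock) (V.segmentUnitary .left)
  right_design : IsLocalDesign 2 V.law (V.blockSupport V.diffBlock) (V.segmentUnitary .right)
  indep : iIndepFun V.segmentUnitary V.law
  gen_pauli : ∃ g : PauliString V.numQubits, g.support.Nonempty ∧ V.gen V.diffGate = g.toOp
  covers : ∀ h ∈ V.terms, ∀ q ∈ h.support, ∃ k, q ∈ V.blockSupport k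

end VQE

/-- A sequence of variational quantum eigensolvers has a barren plateau (for the chosen parameters)
if the variance of the cost derivative vanishes exponentially in the number of qubits. -/
def HasBarrenPlateau (V : ℕ → VQE) : Prop :=
  ∃ b : ℝ, 1 < b ∧
    (fun n => (V n).gradVariance) =O[Filter.atTop] fun n => (b ^ (V n).numQubits)⁻¹

/-!
The proof follows the observable through the circuit in the Heisenberg picture and keeps track of
the second moments of its Pauli coefficients. A local `2`-design on `s` acts on these moments as the
Haar twirl over `s` does: it decorrelates strings that differ on `s`, and it spreads the weight of a
string that is non-trivial on `s` evenly over the strings non-trivial on `s` that agree with it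
elsewhere, so that each of them receives at least the fraction `4 ^ (-|s|)`. Differentiation turns
the observable into its commutator with the generator `g`, which kills the strings commuting with
`g` and multiplies the squared coefficients of the others by `4`; half of the strings agreeing
outside `s` anticommute with `g`, so that the two twirls of the differential block together retain
the fraction `2 * 4 ^ (-|s|)`.

It therefore suffices to follow, for every term of the Hamiltonian, the string in which the
non-trivial entries met so far are replaced by `Z`. After the whole circuit it has expected value
`1` in the state `|0⋯0⟩`, the strings that remain are uncorrelated, and the term has been damped by
at most one factor `4 ^ (-β)` for each of the at most `r * χ` blocks meeting its support.
-/

/-! ### Pauli strings up to phase -/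

namespace Pauli

/-- The product of two Pauli matrices modulo phases. -/
def mul : Pauli → Pauli → Pauli
  | .I, q => q
  | p, .I => p
  | .X, .Y | .Y, .X => .Z
  | .Y, .Z | .Z, .Y => .X
  | .Z, .X | .X, .Z => .Y
  | .X, .X | .Y, .Y | .Z, .Z => .I

/-- The Klein four-group of Pauli matrices modulo phases, with `I` as its neutral element. -/
instance instCommGroup : CommGroup Pauli where
  mul := mul
  one := .I
  inv p := p
  mul_assoc := by rintro (_ | _ | _ | _) (_ | _ | _ | _) (_ | _ | _ | _) <;> rfl
  one_mul := by rintro (_ | _ | _ | _) <;> rfl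
  mul_one := by rintro (_ | _ | _ | _) <;> rfl
  inv_mul_cancel := by rintro (_ | _ | _ | _) <;> rfl
  mul_comm := by rintro (_ | _ | _ | _) (_ | _ | _ | _) <;> rfl

/-- The phase `c` in the product `p q = c r` of Pauli matrices. -/
def phase : Pauli → Pauli → ℂ
  | .X, .Y | .Y, .Z | .Z, .X => Complex.I
  | .Y, .X | .Z, .Y | .X, .Z => -Complex.I
  | _, _ => 1

/-- The commutation sign of two Pauli matrices: `1` if they commute, `-1` if they anticommute. -/
def sign (p q : Pauli) : ℤˣ := if p = 1 ∨ q = 1 ∨ p = q then 1 else -1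

theorem one_eq : (1 : Pauli) = .I := rfl

theorem mul_eq (p q : Pauli) : p * q = mul p q := rfl

theorem mul_self (p : Pauli) : p * p = 1 := inv_mul_cancel p

theorem sign_comm (p q : Pauli) : sign p q = sign q p := by
  revert p q; decide

theorem sign_mul_left (p q r : Pauli) : sign (p * q) r = sign p r * sign q r := by
  revert p q r; decide

theorem exists_sign_eq_neg_one {p : Pauli} (h : p ≠ 1) : ∃ t, sign p t = -1 := by
  revert p; decide

theorem phase_self (p : Pauli) : phase p p = 1 := by
  cases p <;> rfl

theorem phase_comm (p q : Pauli) : phase p q = ((sign p q : ℤ) : ℂ) * phase q p := by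
  cases p <;> cases q <;> simp [phase, sign, one_eq]

theorem phase_sq (p q : Pauli) : phase p q ^ 2 = ((sign p q : ℤ) : ℂ) := by
  cases p <;> cases q <;> simp [phase, sign, one_eq]

theorem toMatrix_mul (p q : Pauli) : p.toMatrix * q.toMatrix = phase p q • (p * q).toMatrix := by
  cases p <;> cases q <;> ext i j <;> fin_cases i <;> fin_cases j <;>
    simp [toMatrix, phase, mul_eq, mul]

theorem toMatrix_isHermitian (p : Pauli) : p.toMatrix.IsHermitian := by
  ext a b
  cases p <;> fin_cases a <;> fin_cases b <;> simp [toMatrix]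

theorem trace_toMatrix (p : Pauli) : p.toMatrix.trace = if p = 1 then 2 else 0 := by
  cases p <;> simp [toMatrix, one_eq, Matrix.trace_fin_two]

theorem sum_toMatrix_mul_toMatrix (a b c d : Fin 2) :
    ∑ p : Pauli, p.toMatrix a b * p.toMatrix c d = if a = d ∧ b = c then 2 else 0 := by
  have sum_univ (f : Pauli → ℂ) : ∑ p, f p = f .I + (f .X + (f .Y + f .Z)) := by
    change Finset.sum ⟨_, _⟩ _ = _
    simp [Finset.sum]
  rw [sum_univ]
  fin_cases a <;> fin_cases b <;> fin_cases c <;> fin_cases d <;>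
    simp [toMatrix, one_add_one_eq_two]

theorem toMatrix_zero_zero (p : Pauli) : p.toMatrix 0 0 = if p = 1 ∨ p = .Z then 1 else 0 := by
  cases p <;> simp [toMatrix, one_eq]

end Pauli

namespace PauliString

variable {N : ℕ}

/-- The phase `c` in the product `P Q = c R` of Pauli strings. -/
noncomputable def phase (P Q : PauliString N) : ℂ := ∏ i, (P i).phase (Q i)

/-- The commutation sign of two Pauli strings: `1` if they commute, `-1` if they anticommute. -/
def sign (P Q : PauliString N) : ℤˣ := ∏ i, (P i).sign (Q i)

theorem mem_support {P : PauliString N} {q : Fin N} : q ∈ P.support ↔ P q ≠ 1 := by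
  simp [support, Pauli.one_eq]

theorem notMem_support {P : PauliString N} {q : Fin N} : q ∉ P.support ↔ P q = 1 :=
  mem_support.not_left

theorem mul_self (P : PauliString N) : P * P = 1 := funext fun _ => Pauli.mul_self _

theorem mul_mul_cancel (P Q : PauliString N) : P * Q * Q = P := by
  rw [mul_assoc, mul_self, mul_one]

theorem mul_eq_one_iff {P Q : PauliString N} : P * Q = 1 ↔ P = Q :=
  mul_eq_one_iff_eq_inv

theorem mem_support_mul {P Q : PauliString N} {q : Fin N} :
    q ∈ (P * Q).support ↔ P q ≠ Q q :=
  mem_support.trans (not_congr mul_eq_one_iff_eq_inv)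

theorem support_mulSingle_subset (q : Fin N) (t : Pauli) :
    PauliString.support (Pi.mulSingle q t) ⊆ {q} := fun i hi => by
  by_contra hiq
  exact mem_support.1 hi (Pi.mulSingle_eq_of_ne (M := fun _ => Pauli) (by simpa using hiq) t)

theorem support_mul_subset (P Q : PauliString N) : (P * Q).support ⊆ P.support ∪ Q.support := by
  intro q hq
  by_contra h
  simp only [Finset.mem_union, not_or, notMem_support] at h
  exact mem_support.1 hq (by simp [h])

theorem sign_comm (P Q : PauliString N) : sign P Q = sign Q P :=
  Finset.prod_congr rfl fun _ _ => Pauli.sign_comm _ _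

theorem sign_mul_left (P Q R : PauliString N) : sign (P * Q) R = sign P R * sign Q R := by
  simp only [sign, Pi.mul_apply, Pauli.sign_mul_left, Finset.prod_mul_distrib]

theorem sign_self (P : PauliString N) : sign P P = 1 :=
  Finset.prod_eq_one fun _ _ => by simp [Pauli.sign]

theorem sign_mulSingle (P : PauliString N) (q : Fin N) (t : Pauli) :
    sign P (Pi.mulSingle q t) = (P q).sign t := by
  rw [sign, Finset.prod_eq_single q] <;> simp +contextual [Pauli.sign]

theorem exists_sign_eq_neg_one {P : PauliString N} {s : Finset (Fin N)}
    (h : ¬ Disjoint P.support s) : ∃ D : PauliString N, D.support ⊆ s ∧ sign P D = -1 := by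
  obtain ⟨q, hqP, hqs⟩ := Finset.not_disjoint_iff.1 h
  obtain ⟨t, ht⟩ := Pauli.exists_sign_eq_neg_one (mem_support.1 hqP)
  exact ⟨Pi.mulSingle q t, (support_mulSingle_subset q t).trans (Finset.singleton_subset_iff.2 hqs),
    by rw [sign_mulSingle, ht]⟩

theorem sign_mul_right (P Q R : PauliString N) : sign P (Q * R) = sign P Q * sign P R := by
  simp only [sign_comm P, sign_mul_left]

theorem exists_sign_eq_neg_one_both {P Q : PauliString N} {s : Finset (Fin N)}
    (hP : ¬ Disjoint P.support s) (hQ : ¬ Disjoint Q.support s) :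
    ∃ D : PauliString N, D.support ⊆ s ∧ sign P D = -1 ∧ sign Q D = -1 := by
  obtain ⟨D, hD, hPD⟩ := exists_sign_eq_neg_one hP
  obtain ⟨E, hE, hQE⟩ := exists_sign_eq_neg_one hQ
  rcases Int.units_eq_one_or (sign Q D) with hQD | hQD
  · rcases Int.units_eq_one_or (sign P E) with hPE | hPE
    · refine ⟨D * E, (support_mul_subset D E).trans (Finset.union_subset hD hE), ?_, ?_⟩ <;>
        simp [sign_mul_right, hPD, hPE, hQD, hQE]
    · exact ⟨E, hE, hPE, hQE⟩
  · exact ⟨D, hD, hPD, hQD⟩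

theorem phase_self (P : PauliString N) : phase P P = 1 :=
  Finset.prod_eq_one fun _ _ => Pauli.phase_self _

theorem phase_comm (P Q : PauliString N) : phase P Q = ((sign P Q : ℤ) : ℂ) * phase Q P := by
  simp only [phase, sign, Units.coe_prod, Int.cast_prod, ← Finset.prod_mul_distrib]
  exact Finset.prod_congr rfl fun _ _ => Pauli.phase_comm _ _

theorem phase_sq (P Q : PauliString N) : phase P Q ^ 2 = ((sign P Q : ℤ) : ℂ) := by
  simp [phase, sign, ← Finset.prod_pow, Pauli.phase_sq]

/-! ### The Pauli basis -/

theorem toOp_apply (P : PauliString N) (x y : Fin N → Fin 2) :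
    P.toOp x y = ∏ i, (P i).toMatrix (x i) (y i) := rfl

theorem toOp_one : (1 : PauliString N).toOp = 1 := by
  ext x y
  simp [toOp_apply, Pauli.toMatrix, Matrix.one_apply, Finset.prod_ite_zero, funext_iff]

theorem toOp_mul (P Q : PauliString N) : P.toOp * Q.toOp = phase P Q • (P * Q).toOp := by
  ext x z
  simp only [Matrix.mul_apply, toOp_apply, Matrix.smul_apply, ← Finset.prod_mul_distrib, phase,
    smul_eq_mul, Pi.mul_apply]
  refine (Fintype.prod_sum fun i b => (P i).toMatrix (x i) b * (Q i).toMatrix b (z i)).symm.trans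
    (Finset.prod_congr rfl fun i _ => ?_)
  simpa [Matrix.mul_apply] using congr($(Pauli.toMatrix_mul (P i) (Q i)) (x i) (z i))

theorem toOp_mul_self (P : PauliString N) : P.toOp * P.toOp = 1 := by
  rw [toOp_mul, mul_self, phase_self, one_smul, toOp_one]

theorem toOp_mul_comm (P Q : PauliString N) :
    P.toOp * Q.toOp = ((sign P Q : ℤ) : ℂ) • (Q.toOp * P.toOp) := by
  rw [toOp_mul, toOp_mul, mul_comm P Q, phase_comm, smul_smul]

theorem sign_eq_one_of_commute {P Q : PauliString N} (h : Commute P.toOp Q.toOp) :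
    sign P Q = 1 := by
  by_contra hsign
  have hanti : P.toOp * Q.toOp = -(Q.toOp * P.toOp) := by
    simp [toOp_mul_comm P Q, (Int.units_eq_one_or _).resolve_left hsign]
  have hzero : P.toOp * Q.toOp = 0 := by
    rw [← h.eq] at hanti
    exact Matrix.ext fun x y => self_eq_neg.1 congr($hanti x y)
  have hone : (1 : QOp N) = P.toOp * Q.toOp * (Q.toOp * P.toOp) := by
    rw [mul_assoc, ← mul_assoc Q.toOp, toOp_mul_self, one_mul, toOp_mul_self]
  rw [hzero, zero_mul] at hone
  exact one_ne_zero hone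

theorem toOp_isHermitian (P : PauliString N) : P.toOp.IsHermitian := by
  ext x y
  simp only [Matrix.conjTranspose_apply, toOp_apply, star_prod,
    (Pauli.toMatrix_isHermitian _).apply]

theorem toOp_zero_zero (P : PauliString N) :
    P.toOp 0 0 = if ∀ i, P i = 1 ∨ P i = .Z then 1 else 0 := by
  simp [toOp_apply, Pauli.toMatrix_zero_zero, Finset.prod_ite_zero]

theorem trace_toOp (P : PauliString N) : P.toOp.trace = if P = 1 then 2 ^ N else 0 := by
  simp only [Matrix.trace, Matrix.diag, toOp_apply]
  refine (Fintype.prod_sum fun i b => (P i).toMatrix b b).symm.trans ?_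
  have htrace (i : Fin N) : ∑ b, (P i).toMatrix b b = if P i = 1 then 2 else 0 :=
    Pauli.trace_toMatrix _
  simp [htrace, Finset.prod_ite_zero, funext_iff]

theorem trace_toOp_mul_toOp (P Q : PauliString N) :
    (P.toOp * Q.toOp).trace = if P = Q then 2 ^ N else 0 := by
  split_ifs with h
  · simp [h, toOp_mul_self]
  · simp [toOp_mul, trace_toOp, mul_eq_one_iff, h]

theorem sum_toOp_mul_toOp (x y z w : Fin N → Fin 2) :
    ∑ P : PauliString N, P.toOp x y * P.toOp z w = if x = w ∧ y = z then 2 ^ N else 0 := by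
  simp only [toOp_apply, ← Finset.prod_mul_distrib]
  refine (Fintype.prod_sum fun i (p : Pauli) =>
    p.toMatrix (x i) (y i) * p.toMatrix (z i) (w i)).symm.trans ?_
  simp [Pauli.sum_toMatrix_mul_toMatrix, Finset.prod_ite_zero, funext_iff, forall_and]

theorem sum_trace_smul_toOp (A : QOp N) :
    ∑ Q : PauliString N, ((2 ^ N : ℂ)⁻¹ * (Q.toOp * A).trace) • Q.toOp = A := by
  ext x y
  simp only [Matrix.sum_apply, Matrix.smul_apply, smul_eq_mul, mul_assoc, ← Finset.mul_sum]
  rw [inv_mul_eq_iff_eq_mul₀ (by simp)]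
  calc ∑ Q : PauliString N, (Q.toOp * A).trace * Q.toOp x y
      = ∑ z, ∑ w, A w z * ∑ Q : PauliString N, Q.toOp z w * Q.toOp x y := by
        simp only [Matrix.trace, Matrix.diag, Matrix.mul_apply, Finset.sum_mul, Finset.mul_sum]
        rw [Finset.sum_comm]
        refine Finset.sum_congr rfl fun z _ => ?_
        rw [Finset.sum_comm]
        exact Finset.sum_congr rfl fun w _ => Finset.sum_congr rfl fun Q _ => by ring
    _ = 2 ^ N * A x y := by
        simp only [sum_toOp_mul_toOp, mul_ite, mul_zero]
        rw [Finset.sum_eq_single y, Finset.sum_eq_single x] <;> simp +contextual [mul_comm, eq_comm]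

/-- The real part of the coefficient of a Pauli string in the Pauli expansion of an operator. -/
noncomputable def coeff (Q : PauliString N) : QOp N →ₗ[ℝ] ℝ :=
  (2 ^ N : ℝ)⁻¹ • Complex.reLm ∘ₗ Matrix.traceLinearMap _ ℝ ℂ ∘ₗ LinearMap.mulLeft ℝ Q.toOp

theorem coeff_apply (Q : PauliString N) (A : QOp N) :
    coeff Q A = (2 ^ N : ℝ)⁻¹ * (Q.toOp * A).trace.re := rfl

theorem ofReal_coeff (Q : PauliString N) {A : QOp N} (hA : A.IsHermitian) :
    (coeff Q A : ℂ) = (2 ^ N : ℂ)⁻¹ * (Q.toOp * A).trace := by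
  have htrace : (((Q.toOp * A).trace.re : ℝ) : ℂ) = (Q.toOp * A).trace := by
    rw [← Complex.conj_eq_iff_re, ← Complex.star_def, ← Matrix.trace_conjTranspose,
      Matrix.conjTranspose_mul, hA.eq, Q.toOp_isHermitian.eq, Matrix.trace_mul_comm]
  rw [coeff_apply, Complex.ofReal_mul, htrace]
  simp

theorem coeff_toOp (P Q : PauliString N) : coeff Q P.toOp = if Q = P then 1 else 0 := by
  rw [← Complex.ofReal_inj, ofReal_coeff Q P.toOp_isHermitian, trace_toOp_mul_toOp]
  split_ifs <;> simp

theorem sum_coeff_smul_toOp {A : QOp N} (hA : A.IsHermitian) :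
    ∑ Q : PauliString N, coeff Q A • Q.toOp = A := by
  simp only [← Complex.coe_smul, ofReal_coeff _ hA, sum_trace_smul_toOp]

theorem coeff_mul_self {A : QOp N} (hA : A.IsHermitian) :
    coeff 1 (A * A) = ∑ Q : PauliString N, coeff Q A ^ 2 := by
  calc coeff 1 (A * A) = coeff 1 ((∑ Q : PauliString N, coeff Q A • Q.toOp) * A) := by
        rw [sum_coeff_smul_toOp hA]
    _ = ∑ Q : PauliString N, coeff Q A ^ 2 := by
        simp only [Finset.sum_mul, map_sum, Matrix.smul_mul, map_smul, smul_eq_mul, sq]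
        simp [coeff_apply, toOp_one]

theorem sum_coeff_sq_of_mul_self_eq_one {A : QOp N} (hA : A.IsHermitian) (hAA : A * A = 1) :
    ∑ Q : PauliString N, coeff Q A ^ 2 = 1 := by
  rw [← coeff_mul_self hA, hAA, ← toOp_one, coeff_toOp, if_pos rfl]

/-- The real structure constant `c` in `i[P, Q] = c R`, where `R` is the product string. -/
noncomputable def structConst (P Q : PauliString N) : ℝ :=
  if sign P Q = 1 then 0 else 2 * (Complex.I * phase P Q).re

theorem ofReal_structConst (P Q : PauliString N) :
    (structConst P Q : ℂ) = Complex.I * (phase P Q - phase Q P) := by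
  have hcomm := phase_comm Q P
  have hsq := phase_sq P Q
  rw [sign_comm] at hcomm
  rcases Int.units_eq_one_or (sign P Q) with h | h <;> rw [h] at hcomm hsq
  · simp [structConst, h, hcomm]
  · have hphase : phase P Q = Complex.I ∨ phase P Q = -Complex.I := by
      rw [← sq_eq_sq_iff_eq_or_eq_neg, hsq]; simp
    rcases hphase with hI | hI <;> simp [structConst, h, hcomm, hI]
    · linear_combination (-2) * Complex.I_sq
    · linear_combination 2 * Complex.I_sq

theorem structConst_sq (P Q : PauliString N) :
    structConst P Q ^ 2 = if sign P Q = -1 then 4 else 0 := by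
  have hcomm := phase_comm Q P
  rw [sign_comm] at hcomm
  rw [← Complex.ofReal_inj, Complex.ofReal_pow, ofReal_structConst, mul_pow]
  rcases Int.units_eq_one_or (sign P Q) with h | h <;> rw [h] at hcomm
  · simp [h, hcomm]
  · have hsq := phase_sq P Q
    rw [h] at hsq
    simp only [h, hcomm, if_true, Complex.I_sq]
    push_cast at hsq ⊢
    linear_combination (-4) * hsq

/-- The commutator `i[P, A]`, which is Hermitian whenever `A` is. -/
noncomputable def commutator (P : PauliString N) (A : QOp N) : QOp N :=
  Complex.I • (P.toOp * A - A * P.toOp)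

theorem commutator_isHermitian (P : PauliString N) {A : QOp N} (hA : A.IsHermitian) :
    (commutator P A).IsHermitian := by
  rw [commutator, Matrix.IsHermitian, Matrix.conjTranspose_smul, Matrix.conjTranspose_sub,
    Matrix.conjTranspose_mul, Matrix.conjTranspose_mul, hA.eq, P.toOp_isHermitian.eq,
    Complex.star_def, Complex.conj_I, neg_smul, ← smul_neg, neg_sub]

theorem coeff_commutator (P Q : PauliString N) (A : QOp N) :
    coeff Q (commutator P A) = structConst Q P * coeff (Q * P) A := by
  have hcycle : (Q.toOp * (A * P.toOp)).trace = (P.toOp * Q.toOp * A).trace := by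
    rw [← mul_assoc, Matrix.trace_mul_comm, ← mul_assoc]
  have htrace : (Q.toOp * commutator P A).trace
      = (structConst Q P : ℂ) * ((Q * P).toOp * A).trace := by
    rw [commutator, Matrix.mul_smul, Matrix.trace_smul, mul_sub, Matrix.trace_sub, hcycle,
      ← mul_assoc, toOp_mul, toOp_mul, mul_comm P Q, ofReal_structConst]
    simp only [Matrix.smul_mul, Matrix.trace_smul, smul_eq_mul]
    ring
  rw [coeff_apply, htrace, Complex.re_ofReal_mul, coeff_apply]
  ring

end PauliString

/-! ### Local operators -/

section LocalOperators

open PauliString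
open scoped Kronecker Matrix

variable {N : ℕ}

namespace PauliString

/-- The tensor product of the letters of a Pauli string over the qubits satisfying `p`. -/
noncomputable def partialOp (P : PauliString N) (p : Fin N → Prop) [DecidablePred p] :
    Matrix ({i // p i} → Fin 2) ({i // p i} → Fin 2) ℂ :=
  Matrix.of fun x y => ∏ i : {i // p i}, (P i).toMatrix (x i) (y i)

theorem partialOp_eq_one {P : PauliString N} {p : Fin N → Prop} [DecidablePred p]
    (hP : ∀ i, p i → P i = 1) : P.partialOp p = 1 := by
  have hentry (i : {i // p i}) (a b : Fin 2) :
      (P i).toMatrix a b = if a = b then 1 else 0 := by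
    rw [hP i i.2]; rfl
  ext x y
  simp [partialOp, hentry, Matrix.one_apply, Finset.prod_ite_zero, funext_iff]

variable (s : Finset (Fin N))

theorem toOp_eq_submatrix (P : PauliString N) :
    P.toOp = (P.partialOp (· ∈ s) ⊗ₖ P.partialOp (· ∉ s)).submatrix
      (Equiv.piEquivPiSubtypeProd (· ∈ s) fun _ => Fin 2)
      (Equiv.piEquivPiSubtypeProd (· ∈ s) fun _ => Fin 2) := by
  ext x y
  exact (Fintype.prod_subtype_mul_prod_subtype (· ∈ s)
    fun i => (P i).toMatrix (x i) (y i)).symm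

end PauliString

variable (s : Finset (Fin N))

theorem embedOp_eq_submatrix (V : Matrix (s → Fin 2) (s → Fin 2) ℂ) :
    embedOp s V = (V ⊗ₖ (1 : Matrix ({i // i ∉ s} → Fin 2) ({i // i ∉ s} → Fin 2) ℂ)).submatrix
      (Equiv.piEquivPiSubtypeProd (· ∈ s) fun _ => Fin 2)
      (Equiv.piEquivPiSubtypeProd (· ∈ s) fun _ => Fin 2) := by
  ext x y
  simp [embedOp, Matrix.one_apply, funext_iff, Equiv.piEquivPiSubtypeProd]

/-- The embedding `V ↦ V ⊗ I` of the operators on the qubits in `s` as a star-algebra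
homomorphism. -/
noncomputable def embedHom : Matrix (s → Fin 2) (s → Fin 2) ℂ →⋆ₐ[ℂ] QOp N where
  toFun := embedOp s
  map_one' := by
    rw [embedOp_eq_submatrix, Matrix.one_kronecker_one, Matrix.submatrix_one_equiv]
  map_mul' V W := by
    simp only [embedOp_eq_submatrix, Matrix.submatrix_mul_equiv, ← Matrix.mul_kronecker_mul,
      one_mul]
  map_zero' := by ext x y; simp [embedOp]
  map_add' V W := by
    simp only [embedOp_eq_submatrix, Matrix.add_kronecker, Matrix.submatrix_add, Pi.add_apply]
  commutes' c := by
    rw [Algebra.algebraMap_eq_smul_one, Algebra.algebraMap_eq_smul_one, embedOp_eq_submatrix,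
      Matrix.smul_kronecker, Matrix.one_kronecker_one, ← Matrix.submatrix_one_equiv
        (Equiv.piEquivPiSubtypeProd (· ∈ s) fun _ => Fin 2)]
    rfl
  map_star' V := by
    simp only [embedOp_eq_submatrix, Matrix.star_eq_conjTranspose,
      Matrix.conjTranspose_submatrix, Matrix.conjTranspose_kronecker, Matrix.conjTranspose_one]

theorem embedHom_apply (V : Matrix (s → Fin 2) (s → Fin 2) ℂ) : embedHom s V = embedOp s V := rfl

theorem embedHom_injective : Function.Injective (embedHom s) := by
  intro V W h
  ext a b
  simpa +contextual [embedHom_apply, embedOp] using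
    congr($h (fun i => if hi : i ∈ s then a ⟨i, hi⟩ else 0)
      (fun i => if hi : i ∈ s then b ⟨i, hi⟩ else 0))

theorem continuous_embedHom : Continuous (embedHom s) := by
  refine continuous_matrix fun x y => ?_
  simp only [embedHom_apply, embedOp, Matrix.of_apply]
  split_ifs <;> fun_prop

/-- The embedding `V ↦ V ⊗ I` of the unitary group of the qubits in `s`. -/
noncomputable def localUnitary :
    Matrix.unitaryGroup (s → Fin 2) ℂ →⋆* Matrix.unitaryGroup (Fin N → Fin 2) ℂ :=
  Unitary.map ⟨(embedHom s : _ →* QOp N), map_star (embedHom s)⟩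

theorem continuous_localUnitary : Continuous fun W => (localUnitary s W : QOp N) :=
  (continuous_embedHom s).comp continuous_subtype_val

variable {s}

theorem exists_localUnitary_eq {A : QOp N} (hA : A ∈ (embedHom s).range)
    (hunit : A ∈ Matrix.unitaryGroup (Fin N → Fin 2) ℂ) :
    ∃ u : Matrix.unitaryGroup (s → Fin 2) ℂ, (localUnitary s u : QOp N) = A := by
  obtain ⟨V, rfl⟩ := hA
  refine ⟨⟨V, Matrix.mem_unitaryGroup_iff.2 (embedHom_injective s ?_)⟩, rfl⟩
  rw [map_mul, map_star, map_one]
  exact Matrix.mem_unitaryGroup_iff.1 hunit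

namespace PauliString

theorem toOp_mem_range_embedHom {P : PauliString N} (hP : P.support ⊆ s) :
    P.toOp ∈ (embedHom s).range := by
  refine ⟨P.partialOp (· ∈ s), ?_⟩
  change embedOp s _ = _
  rw [embedOp_eq_submatrix, toOp_eq_submatrix s,
    partialOp_eq_one (p := (· ∉ s)) fun i hi => notMem_support.1 fun h => hi (hP h)]

theorem commute_toOp_embedOp {P : PauliString N} (hP : Disjoint P.support s)
    (V : Matrix (s → Fin 2) (s → Fin 2) ℂ) : Commute P.toOp (embedOp s V) := by
  rw [Commute, SemiconjBy, embedOp_eq_submatrix, toOp_eq_submatrix s,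
    partialOp_eq_one (p := (· ∈ s)) fun i hi => notMem_support.1 (Finset.disjoint_right.1 hP hi)]
  simp only [Matrix.submatrix_mul_equiv, ← Matrix.mul_kronecker_mul, Matrix.one_mul,
    Matrix.mul_one]

theorem toOp_mem_unitaryGroup (P : PauliString N) :
    P.toOp ∈ Matrix.unitaryGroup (Fin N → Fin 2) ℂ := by
  rw [Matrix.mem_unitaryGroup_iff, Matrix.star_eq_conjTranspose, P.toOp_isHermitian.eq,
    toOp_mul_self]

theorem support_subset_opSupport (P : PauliString N) : P.support ⊆ opSupport P.toOp := by
  intro q hq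
  simp only [opSupport, Finset.mem_filter, Finset.mem_univ, true_and]
  rintro ⟨V, hV⟩
  obtain ⟨t, ht⟩ := Pauli.exists_sign_eq_neg_one (mem_support.1 hq)
  have hdisj : Disjoint (PauliString.support (Pi.mulSingle q t)) (Finset.univ.erase q) :=
    Finset.disjoint_of_subset_left (support_mulSingle_subset q t) (by simp)
  have hcomm := commute_toOp_embedOp hdisj V
  rw [← hV] at hcomm
  have hsign := sign_eq_one_of_commute hcomm.symm
  rw [sign_mulSingle, ht] at hsign
  contradiction

end PauliString

end LocalOperators

/-! ### Pauli transfer matrices -/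

section Transfer

open PauliString
open scoped Matrix

variable {N : ℕ}

/-- The evolution `A ↦ B† A B` of operators in the Heisenberg picture. -/
noncomputable def heisenberg (B : QOp N) : QOp N →ₗ[ℝ] QOp N :=
  LinearMap.mulRight ℝ B ∘ₗ LinearMap.mulLeft ℝ Bᴴ

theorem heisenberg_apply (B A : QOp N) : heisenberg B A = Bᴴ * A * B := rfl

theorem heisenberg_mul (B C A : QOp N) : heisenberg (B * C) A = heisenberg C (heisenberg B A) := by
  simp only [heisenberg_apply, Matrix.conjTranspose_mul, mul_assoc]

theorem heisenberg_isHermitian (B : QOp N) {A : QOp N} (hA : A.IsHermitian) :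
    (heisenberg B A).IsHermitian := by
  simp only [heisenberg_apply, Matrix.IsHermitian, Matrix.conjTranspose_mul, hA.eq,
    Matrix.conjTranspose_conjTranspose, mul_assoc]

theorem heisenberg_eq_of_commute (B : Matrix.unitaryGroup (Fin N → Fin 2) ℂ) {A : QOp N}
    (h : Commute A (B : QOp N)) : heisenberg B A = A := by
  rw [heisenberg_apply, mul_assoc, h.eq, ← mul_assoc, ← Matrix.star_eq_conjTranspose,
    Matrix.mem_unitaryGroup_iff'.1 B.2, one_mul]

theorem heisenberg_unitary_mul (B : Matrix.unitaryGroup (Fin N → Fin 2) ℂ) (A C : QOp N) :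
    heisenberg B (A * C) = heisenberg B A * heisenberg B C := by
  have hB : (B : QOp N) * (B : QOp N)ᴴ = 1 := Matrix.mem_unitaryGroup_iff.1 B.2
  calc (B : QOp N)ᴴ * (A * C) * B = (B : QOp N)ᴴ * A * 1 * C * B := by
        simp only [mul_assoc, one_mul]
    _ = heisenberg B A * heisenberg B C := by rw [← hB]; simp only [heisenberg_apply, mul_assoc]

theorem heisenberg_one_right (B : Matrix.unitaryGroup (Fin N → Fin 2) ℂ) :
    heisenberg (B : QOp N) 1 = 1 :=
  heisenberg_eq_of_commute B (Commute.one_left _)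

theorem heisenberg_toOp_toOp (S P : PauliString N) :
    heisenberg S.toOp P.toOp = ((sign P S : ℤ) : ℝ) • P.toOp := by
  rw [heisenberg_apply, S.toOp_isHermitian.eq, mul_assoc, toOp_mul_comm, Matrix.mul_smul,
    ← mul_assoc, toOp_mul_self, one_mul, ← Complex.coe_smul, Complex.ofReal_intCast]

theorem coeff_heisenberg_eq_trace (B A : QOp N) (Q : PauliString N) :
    coeff Q (heisenberg B A) = (2 ^ N : ℝ)⁻¹ * (heisenberg Bᴴ Q.toOp * A).trace.re := by
  rw [coeff_apply, heisenberg_apply, heisenberg_apply, Matrix.conjTranspose_conjTranspose,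
    ← mul_assoc, ← mul_assoc, Matrix.trace_mul_comm]
  simp only [mul_assoc]

/-- The Pauli transfer matrix of the Heisenberg evolution by `B`. -/
noncomputable def transfer (B : QOp N) (P Q : PauliString N) : ℝ := coeff Q (heisenberg B P.toOp)

theorem coeff_heisenberg (B : QOp N) {A : QOp N} (hA : A.IsHermitian) (Q : PauliString N) :
    coeff Q (heisenberg B A) = ∑ P, coeff P A * transfer B P Q := by
  conv_lhs => rw [← sum_coeff_smul_toOp hA]
  simp [transfer]

theorem coeff_heisenberg_mul_coeff_heisenberg (B : QOp N) {A : QOp N} (hA : A.IsHermitian)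
    (Q Q' : PauliString N) :
    coeff Q (heisenberg B A) * coeff Q' (heisenberg B A) =
      ∑ P, ∑ P', coeff P A * coeff P' A * (transfer B P Q * transfer B P' Q') := by
  rw [coeff_heisenberg B hA, coeff_heisenberg B hA, Finset.sum_mul_sum]
  exact Finset.sum_congr rfl fun P _ => Finset.sum_congr rfl fun P' _ => mul_mul_mul_comm _ _ _ _

theorem coeff_heisenberg_toOp (S Q : PauliString N) (A : QOp N) :
    coeff Q (heisenberg S.toOp A) = (sign Q S : ℤ) * coeff Q A := by
  rw [coeff_heisenberg_eq_trace, S.toOp_isHermitian.eq, heisenberg_toOp_toOp, Matrix.smul_mul,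
    Matrix.trace_smul, Complex.smul_re, smul_eq_mul, coeff_apply]
  ring

theorem transfer_mul_toOp (B : QOp N) (S P Q : PauliString N) :
    transfer (B * S.toOp) P Q = (sign Q S : ℤ) * transfer B P Q := by
  rw [transfer, heisenberg_mul, coeff_heisenberg_toOp, transfer]

theorem transfer_toOp_mul (B : QOp N) (S P Q : PauliString N) :
    transfer (S.toOp * B) P Q = (sign P S : ℤ) * transfer B P Q := by
  rw [transfer, heisenberg_mul, heisenberg_toOp_toOp, map_smul, map_smul, smul_eq_mul, transfer]

theorem sum_transfer_sq (B : Matrix.unitaryGroup (Fin N → Fin 2) ℂ) (P : PauliString N) :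
    ∑ Q, transfer B P Q ^ 2 = 1 := by
  refine sum_coeff_sq_of_mul_self_eq_one (heisenberg_isHermitian _ P.toOp_isHermitian) ?_
  rw [← heisenberg_unitary_mul, toOp_mul_self, heisenberg_one_right]

theorem abs_transfer_le_one (B : Matrix.unitaryGroup (Fin N → Fin 2) ℂ) (P Q : PauliString N) :
    |transfer B P Q| ≤ 1 := by
  rw [← sq_le_one_iff_abs_le_one, ← sum_transfer_sq B P]
  exact Finset.single_le_sum (f := fun Q => transfer B P Q ^ 2) (fun _ _ => sq_nonneg _)
    (Finset.mem_univ Q)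

variable {s : Finset (Fin N)}

theorem heisenberg_localUnitary_of_disjoint {P : PauliString N} (hP : Disjoint P.support s)
    (W : Matrix.unitaryGroup (s → Fin 2) ℂ) : heisenberg (localUnitary s W) P.toOp = P.toOp :=
  heisenberg_eq_of_commute _ (commute_toOp_embedOp hP _)

theorem transfer_localUnitary_of_disjoint_left {P : PauliString N} (hP : Disjoint P.support s)
    (W : Matrix.unitaryGroup (s → Fin 2) ℂ) (Q : PauliString N) :
    transfer (localUnitary s W) P Q = if Q = P then 1 else 0 := by
  rw [transfer, heisenberg_localUnitary_of_disjoint hP, coeff_toOp]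

theorem transfer_localUnitary_of_disjoint_right {Q : PauliString N} (hQ : Disjoint Q.support s)
    (W : Matrix.unitaryGroup (s → Fin 2) ℂ) (P : PauliString N) :
    transfer (localUnitary s W) P Q = if Q = P then 1 else 0 := by
  have hinv : heisenberg (localUnitary s W : QOp N)ᴴ Q.toOp = Q.toOp := by
    simpa only [map_star, Unitary.coe_star, Matrix.star_eq_conjTranspose] using
      heisenberg_localUnitary_of_disjoint hQ (star W)
  rw [transfer, coeff_heisenberg_eq_trace, hinv, ← coeff_apply, coeff_toOp]

theorem transfer_localUnitary_eq_zero {P Q : PauliString N} (h : ¬ (P * Q).support ⊆ s)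
    (W : Matrix.unitaryGroup (s → Fin 2) ℂ) : transfer (localUnitary s W) P Q = 0 := by
  have hdisj : ¬ Disjoint (P * Q).support sᶜ := by rwa [disjoint_compl_right_iff]
  obtain ⟨D, hD, hsign⟩ := exists_sign_eq_neg_one hdisj
  have hcomm : D.toOp * localUnitary s W = localUnitary s W * D.toOp :=
    commute_toOp_embedOp (le_compl_iff_disjoint_right.1 hD) _
  have htransfer := transfer_mul_toOp (localUnitary s W) D P Q
  rw [← hcomm, transfer_toOp_mul] at htransfer
  rw [sign_mul_left] at hsign
  rcases Int.units_eq_one_or (sign P D) with hP | hP <;> rw [hP] at hsign htransfer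
  · rw [one_mul] at hsign
    rw [hsign] at htransfer
    norm_num at htransfer
    linarith
  · have hQ : sign Q D = 1 := by simpa using hsign
    rw [hQ] at htransfer
    norm_num at htransfer
    linarith

end Transfer

/-! ### Haar twirls of local operators -/

theorem integral_sum_sum {Θ ι κ E : Type*} [Fintype ι] [Fintype κ] [NormedAddCommGroup E]
    [NormedSpace ℝ E] {_ : MeasurableSpace Θ} {μ : Measure Θ} {f : ι → κ → Θ → E}
    (hf : ∀ i j, Integrable (f i j) μ) :
    ∫ θ, ∑ i, ∑ j, f i j θ ∂μ = ∑ i, ∑ j, ∫ θ, f i j θ ∂μ := by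
  rw [integral_finsetSum _ fun i _ => integrable_finsetSum _ fun j _ => hf i j]
  exact Finset.sum_congr rfl fun i _ => integral_finsetSum _ fun j _ => hf i j

section HaarInvariance

variable (d : Type*) [Fintype d] [DecidableEq d]

instance instIsProbabilityMeasureHaarUnitary : IsProbabilityMeasure (haarUnitary d) :=
  ⟨Measure.haarMeasure_self (K₀ := ⊤)⟩

instance instIsHaarMeasureHaarUnitary : (haarUnitary d).IsHaarMeasure :=
  inferInstanceAs (Measure.IsHaarMeasure (Measure.haarMeasure _))

instance instIsMulRightInvariantHaarUnitary : (haarUnitary d).IsMulRightInvariant where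
  map_mul_right_eq_self g := by
    have hprob : IsProbabilityMeasure ((haarUnitary d).map (· * g)) :=
      Measure.isProbabilityMeasure_map (by fun_prop)
    exact Measure.isHaarMeasure_eq_of_isProbabilityMeasure _ _

end HaarInvariance

section RandomUnitary

open PauliString

variable {N : ℕ}

instance instBorelSpaceComplexMatrix (m n : Type*) [Countable m] [Countable n] :
    BorelSpace (Matrix m n ℂ) := inferInstanceAs (BorelSpace (m → n → ℂ))

instance instSecondCountableTopologyComplexMatrix (m n : Type*) [Countable m] [Countable n] :
    SecondCountableTopology (Matrix m n ℂ) :=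
  inferInstanceAs (SecondCountableTopology (m → n → ℂ))

theorem continuous_heisenberg (A : QOp N) : Continuous fun B : QOp N => heisenberg B A := by
  simp only [heisenberg_apply]
  fun_prop

theorem PauliString.continuous_coeff (Q : PauliString N) : Continuous (coeff Q) :=
  continuous_const.mul (Complex.continuous_re.comp (by fun_prop))

theorem continuous_transfer (P Q : PauliString N) : Continuous fun B : QOp N => transfer B P Q :=
  (continuous_coeff Q).comp (continuous_heisenberg P.toOp)

/-- A random unitary operator that is measurable with respect to `m`. -/
structure IsRandomUnitary {Θ : Type*} (m : MeasurableSpace Θ) (B : Θ → QOp N) : Prop where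
  measurable : Measurable[m] B
  mem_unitaryGroup : ∀ θ, B θ ∈ Matrix.unitaryGroup (Fin N → Fin 2) ℂ

namespace IsRandomUnitary

variable {Θ : Type*} {m : MeasurableSpace Θ} {B : Θ → QOp N}

theorem localUnitary {s : Finset (Fin N)} {V : Θ → Matrix.unitaryGroup (s → Fin 2) ℂ}
    (hV : Measurable V) : IsRandomUnitary m fun θ => (_root_.localUnitary s (V θ) : QOp N) where
  measurable := (continuous_localUnitary s).measurable.comp hV
  mem_unitaryGroup θ := (_root_.localUnitary s (V θ)).2

theorem measurable_transfer (hB : IsRandomUnitary m B) (P Q : PauliString N) :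
    Measurable fun θ => transfer (B θ) P Q :=
  (continuous_transfer P Q).measurable.comp hB.measurable

theorem abs_transfer_le_one (hB : IsRandomUnitary m B) (P Q : PauliString N) (θ : Θ) :
    |transfer (B θ) P Q| ≤ 1 :=
  _root_.abs_transfer_le_one ⟨B θ, hB.mem_unitaryGroup θ⟩ P Q

theorem integrable_transfer (hB : IsRandomUnitary m B) (μ : Measure Θ) [IsFiniteMeasure μ]
    (P Q : PauliString N) : Integrable (fun θ => transfer (B θ) P Q) μ :=
  .of_bound (hB.measurable_transfer P Q).aestronglyMeasurable 1
    (.of_forall fun θ => hB.abs_transfer_le_one P Q θ)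

theorem integrable_transfer_mul_transfer (hB : IsRandomUnitary m B) (μ : Measure Θ)
    [IsFiniteMeasure μ] (P P' Q Q' : PauliString N) :
    Integrable (fun θ => transfer (B θ) P Q * transfer (B θ) P' Q') μ :=
  (hB.integrable_transfer μ P' Q').bdd_mul (hB.measurable_transfer P Q).aestronglyMeasurable
    (.of_forall fun θ => hB.abs_transfer_le_one P Q θ)

end IsRandomUnitary

end RandomUnitary

section Twirl

open PauliString
open scoped Matrix

variable {N : ℕ} (s : Finset (Fin N))

/-- The Haar averages of products of two Pauli transfer matrix entries of a random unitary on the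
qubits in `s`. They form the matrix of the twirl `A ⊗ A ↦ 𝔼 (B ⊗ B)† (A ⊗ A) (B ⊗ B)`. -/
noncomputable def twirl (P P' Q Q' : PauliString N) : ℝ :=
  ∫ W, transfer (localUnitary s W) P Q * transfer (localUnitary s W) P' Q'
    ∂haarUnitary (s → Fin 2)

theorem twirl_diag_nonneg (P Q : PauliString N) : 0 ≤ twirl s P P Q Q :=
  integral_nonneg fun _ => mul_self_nonneg _

variable {s}

theorem twirl_eq_sign_mul_left {D : PauliString N} (hD : D.support ⊆ s)
    (P P' Q Q' : PauliString N) :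
    twirl s P P' Q Q' = (sign (P * P') D : ℤ) * twirl s P P' Q Q' := by
  obtain ⟨u, hu⟩ := exists_localUnitary_eq (toOp_mem_range_embedHom hD) D.toOp_mem_unitaryGroup
  rw [twirl, ← integral_const_mul]
  refine (integral_mul_left_eq_self _ u).symm.trans (integral_congr_ae (.of_forall fun W => ?_))
  simp only [map_mul, Submonoid.coe_mul, hu, transfer_toOp_mul, sign_mul_left, Units.val_mul,
    Int.cast_mul]
  ring

theorem twirl_eq_sign_mul_right {D : PauliString N} (hD : D.support ⊆ s)
    (P P' Q Q' : PauliString N) :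
    twirl s P P' Q Q' = (sign (Q * Q') D : ℤ) * twirl s P P' Q Q' := by
  obtain ⟨u, hu⟩ := exists_localUnitary_eq (toOp_mem_range_embedHom hD) D.toOp_mem_unitaryGroup
  rw [twirl, ← integral_const_mul]
  refine (integral_mul_right_eq_self _ u).symm.trans (integral_congr_ae (.of_forall fun W => ?_))
  simp only [map_mul, Submonoid.coe_mul, hu, transfer_mul_toOp, sign_mul_left, Units.val_mul,
    Int.cast_mul]
  ring

theorem twirl_eq_zero_of_not_disjoint_left {P P' : PauliString N}
    (h : ¬ Disjoint (P * P').support s) (Q Q' : PauliString N) : twirl s P P' Q Q' = 0 := by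
  obtain ⟨D, hD, hsign⟩ := exists_sign_eq_neg_one h
  have := twirl_eq_sign_mul_left hD P P' Q Q'
  rw [hsign] at this
  norm_num at this
  linarith

theorem twirl_eq_zero_of_not_disjoint_right {Q Q' : PauliString N}
    (h : ¬ Disjoint (Q * Q').support s) (P P' : PauliString N) : twirl s P P' Q Q' = 0 := by
  obtain ⟨D, hD, hsign⟩ := exists_sign_eq_neg_one h
  have := twirl_eq_sign_mul_right hD P P' Q Q'
  rw [hsign] at this
  norm_num at this
  linarith

theorem twirl_eq_zero_of_not_subset_left {P Q : PauliString N} (h : ¬ (P * Q).support ⊆ s)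
    (P' Q' : PauliString N) : twirl s P P' Q Q' = 0 := by
  simp only [twirl, transfer_localUnitary_eq_zero h, zero_mul, integral_zero]

theorem twirl_eq_zero_of_not_subset_right {P' Q' : PauliString N} (h : ¬ (P' * Q').support ⊆ s)
    (P Q : PauliString N) : twirl s P P' Q Q' = 0 := by
  simp only [twirl, transfer_localUnitary_eq_zero h, mul_zero, integral_zero]

theorem eqOn_of_twirl_ne_zero {P P' Q Q' : PauliString N} (h : twirl s P P' Q Q' ≠ 0) {q : Fin N}
    (hq : q ∉ s → P q = P' q) : Q q = Q' q := by
  by_contra hQ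
  by_cases hqs : q ∈ s
  · exact h (twirl_eq_zero_of_not_disjoint_right
      (Finset.not_disjoint_iff.2 ⟨q, mem_support_mul.2 hQ, hqs⟩) P P')
  · have hPQ : P q = Q q := by
      by_contra hne
      exact h (twirl_eq_zero_of_not_subset_left (fun hs => hqs (hs (mem_support_mul.2 hne))) P' Q')
    have hPQ' : P' q = Q' q := by
      by_contra hne
      exact h (twirl_eq_zero_of_not_subset_right (fun hs => hqs (hs (mem_support_mul.2 hne))) P Q)
    exact hQ (hPQ.symm.trans ((hq hqs).trans hPQ'))

theorem twirl_diag_eq_zero {P P' : PauliString N} (h : P ≠ P') (Q : PauliString N) :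
    twirl s P P' Q Q = 0 := by
  by_cases hs : Disjoint (P * P').support s
  · obtain ⟨q, hq⟩ := Function.ne_iff.1 h
    have hqs : q ∉ s := Finset.disjoint_left.1 hs (mem_support_mul.2 hq)
    by_cases hPQ : P q = Q q
    · exact twirl_eq_zero_of_not_subset_right
        (fun hsub => hqs (hsub (mem_support_mul.2 fun hP' => hq (hPQ.trans hP'.symm)))) P Q
    · exact twirl_eq_zero_of_not_subset_left (fun hsub => hqs (hsub (mem_support_mul.2 hPQ))) P' Q
  · exact twirl_eq_zero_of_not_disjoint_left hs Q Q

theorem twirl_self_of_disjoint {P : PauliString N} (hP : Disjoint P.support s) :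
    twirl s P P P P = 1 := by
  simp [twirl, transfer_localUnitary_of_disjoint_left hP]

theorem sum_coeff_mul_twirl {A : QOp N} (hA : A.IsHermitian) (Q Q' : PauliString N) :
    ∑ P, ∑ P', coeff P A * coeff P' A * twirl s P P' Q Q' =
      ∫ W, coeff Q (heisenberg (localUnitary s W : QOp N) A) *
        coeff Q' (heisenberg (localUnitary s W : QOp N) A) ∂haarUnitary (s → Fin 2) := by
  have hint (P P' : PauliString N) :=
    ((IsRandomUnitary.localUnitary (s := s) measurable_id).integrable_transfer_mul_transfer
      (haarUnitary _) P P' Q Q').const_mul (coeff P A * coeff P' A)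
  simp only [id, coeff_heisenberg_mul_coeff_heisenberg _ hA] at hint ⊢
  simp only [integral_sum_sum hint, integral_const_mul, twirl]

theorem sum_coeff_heisenberg_mul_twirl (u : Matrix.unitaryGroup (s → Fin 2) ℂ) {A : QOp N}
    (hA : A.IsHermitian) (Q Q' : PauliString N) :
    ∑ P, ∑ P', coeff P (heisenberg (localUnitary s u : QOp N) A) *
        coeff P' (heisenberg (localUnitary s u : QOp N) A) * twirl s P P' Q Q' =
      ∑ P, ∑ P', coeff P A * coeff P' A * twirl s P P' Q Q' := by
  rw [sum_coeff_mul_twirl (heisenberg_isHermitian _ hA), sum_coeff_mul_twirl hA]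
  refine Eq.trans (integral_congr_ae (.of_forall fun W => ?_)) (integral_mul_left_eq_self _ u)
  simp only [map_mul, Submonoid.coe_mul, heisenberg_mul]

theorem exists_heisenberg_localUnitary_eq {Q Q' : PauliString N} (hQ : (Q' * Q).support ⊆ s)
    (hsign : sign Q Q' = -1) : ∃ u : Matrix.unitaryGroup (s → Fin 2) ℂ,
      heisenberg (localUnitary s u : QOp N)ᴴ Q.toOp = Q'.toOp := by
  set c : ℂ := ((√2 : ℝ) : ℂ)⁻¹
  have hc : c * c = 2⁻¹ := by
    rw [← mul_inv, ← Complex.ofReal_mul, Real.mul_self_sqrt zero_le_two, Complex.ofReal_ofNat]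
  have hanti : Q.toOp * Q'.toOp = -(Q'.toOp * Q.toOp) := by simp [toOp_mul_comm Q Q', hsign]
  set U : QOp N := c • (1 + Q'.toOp * Q.toOp) with hU
  have hUH : Uᴴ = c • (1 + Q.toOp * Q'.toOp) := by
    simp [hU, Matrix.conjTranspose_smul, Matrix.conjTranspose_mul, Q.toOp_isHermitian.eq,
      Q'.toOp_isHermitian.eq, c]
  have hUU : U * Uᴴ = 1 := by
    have hone : Q'.toOp * Q.toOp * (Q.toOp * Q'.toOp) = 1 := by
      rw [mul_assoc, ← mul_assoc Q.toOp, toOp_mul_self, one_mul, toOp_mul_self]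
    rw [hUH, hU, smul_mul_smul_comm, hc, mul_add, add_mul, add_mul, hone, hanti]
    simp only [mul_one, one_mul]
    rw [show (1 : QOp N) + Q'.toOp * Q.toOp + (-(Q'.toOp * Q.toOp) + 1) = (2 : ℂ) • 1 by
      rw [two_smul]; abel, smul_smul, inv_mul_cancel₀ two_ne_zero, one_smul]
  have hmem : U ∈ (embedHom s).range := by
    rw [hU, toOp_mul]
    exact SMulMemClass.smul_mem _ (add_mem (one_mem _)
      (SMulMemClass.smul_mem _ (toOp_mem_range_embedHom hQ)))
  obtain ⟨u, hu⟩ := exists_localUnitary_eq hmem (Matrix.mem_unitaryGroup_iff.2 hUU)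
  refine ⟨u, ?_⟩
  have hswap : U * Q.toOp = Q'.toOp * U := by
    rw [hU, Matrix.smul_mul, Matrix.mul_smul, add_mul, mul_add, mul_assoc,
      ← mul_assoc Q'.toOp Q'.toOp]
    simp only [toOp_mul_self, one_mul, mul_one, add_comm]
  rw [hu, heisenberg_apply, Matrix.conjTranspose_conjTranspose, hswap, mul_assoc, hUU, mul_one]

theorem twirl_diag_eq_of_sign {Q Q' : PauliString N} (hQ : (Q' * Q).support ⊆ s)
    (hsign : sign Q Q' = -1) (P : PauliString N) : twirl s P P Q Q = twirl s P P Q' Q' := by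
  obtain ⟨u, hu⟩ := exists_heisenberg_localUnitary_eq hQ hsign
  refine (integral_mul_right_eq_self _ u).symm.trans (integral_congr_ae (.of_forall fun W => ?_))
  simp only [map_mul, Submonoid.coe_mul, transfer, heisenberg_mul]
  rw [coeff_heisenberg_eq_trace, hu, ← coeff_apply]

theorem twirl_diag_eq_of_not_disjoint {Q Q' : PauliString N} (h : (Q' * Q).support ⊆ s)
    (hQ : ¬ Disjoint Q.support s) (hQ' : ¬ Disjoint Q'.support s) (P : PauliString N) :
    twirl s P P Q Q = twirl s P P Q' Q' := by
  rcases Int.units_eq_one_or (sign Q Q') with hcomm | hanti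
  · obtain ⟨D, hD, hQD, hQD'⟩ := exists_sign_eq_neg_one_both hQ hQ'
    calc twirl s P P Q Q = twirl s P P (D * Q) (D * Q) :=
          twirl_diag_eq_of_sign (by rwa [mul_mul_cancel])
            (by rw [sign_mul_right, hQD, sign_self, mul_one]) P
      _ = twirl s P P Q' Q' := by
        refine twirl_diag_eq_of_sign ?_ ?_ P
        · rw [mul_left_comm]
          exact (support_mul_subset _ _).trans (Finset.union_subset hD h)
        · rw [sign_mul_left, sign_comm D, hQD', hcomm, mul_one]
  · exact twirl_diag_eq_of_sign h hanti P

variable (s)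

/-- The Pauli strings that agree with `P` outside `s`. -/
def agreeOutside (P : PauliString N) : Finset (PauliString N) :=
  Finset.univ.filter fun R => (P * R).support ⊆ s

variable {s}

theorem mem_agreeOutside {P R : PauliString N} : R ∈ agreeOutside s P ↔ (P * R).support ⊆ s := by
  simp [agreeOutside]

variable (s)

theorem card_agreeOutside (P : PauliString N) : (agreeOutside s P).card = 4 ^ s.card := by
  have hmem (R : PauliString N) : R ∈ agreeOutside s P ↔
      R ∈ Fintype.piFinset fun q => if q ∈ s then Finset.univ else {P q} := by
    simp only [mem_agreeOutside, Finset.subset_iff, mem_support_mul, Fintype.mem_piFinset]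
    refine forall_congr' fun q => ?_
    by_cases hq : q ∈ s <;> simp [hq, eq_comm]
  rw [Finset.ext hmem, Fintype.card_piFinset]
  simp [apply_ite Finset.card, Finset.prod_ite_mem, show Fintype.card Pauli = 4 from rfl]

theorem sum_twirl_diag (P : PauliString N) : ∑ R ∈ agreeOutside s P, twirl s P P R R = 1 := by
  have hint (R : PauliString N) :=
    (IsRandomUnitary.localUnitary (s := s) measurable_id).integrable_transfer_mul_transfer
      (haarUnitary _) P P R R
  calc ∑ R ∈ agreeOutside s P, twirl s P P R R = ∑ R, twirl s P P R R :=
        Finset.sum_subset (Finset.subset_univ _) fun R _ hR =>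
          twirl_eq_zero_of_not_subset_left (fun h => hR (mem_agreeOutside.2 h)) P R
    _ = ∫ W, ∑ R, transfer (localUnitary s W) P R * transfer (localUnitary s W) P R
          ∂haarUnitary (s → Fin 2) := (integral_finsetSum _ fun R _ => hint R).symm
    _ = 1 := by simp [← sq, sum_transfer_sq]

variable {s}

theorem inv_le_twirl {P Q : PauliString N} (h : (P * Q).support ⊆ s)
    (hP : ¬ Disjoint P.support s) (hQ : ¬ Disjoint Q.support s) :
    (4 ^ s.card : ℝ)⁻¹ ≤ twirl s P P Q Q := by
  have hle : ∀ R ∈ agreeOutside s P, twirl s P P R R ≤ twirl s P P Q Q := by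
    intro R hR
    by_cases hRs : Disjoint R.support s
    · have hRP : R ≠ P := fun hRP => hP (hRP ▸ hRs)
      simpa [twirl, transfer_localUnitary_of_disjoint_right hRs, hRP] using twirl_diag_nonneg s P Q
    · refine (twirl_diag_eq_of_not_disjoint ?_ hRs hQ P).le
      rw [show Q * R = P * Q * (P * R) by
        rw [mul_comm P Q, mul_assoc, ← mul_assoc P, mul_self, one_mul]]
      exact (support_mul_subset _ _).trans (Finset.union_subset h (mem_agreeOutside.1 hR))
  have hsum := Finset.sum_le_card_nsmul _ _ _ hle
  rw [sum_twirl_diag, card_agreeOutside, nsmul_eq_mul] at hsum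
  push_cast at hsum
  rwa [inv_le_iff_one_le_mul₀' (by positivity)]

end Twirl

/-! ### Second moments of local designs -/

section UnitaryDesign

open scoped Matrix

variable {Θ d : Type*} [MeasurableSpace Θ] {μ : Measure Θ}

/-- The monomial `V i j * V† k l` in the entries of `V` and `V†`, indexed by `((i, j), (k, l))`. -/
def unitaryMonomial (V : Matrix d d ℂ) (τ : (d × d) × (d × d)) : ℂ :=
  V τ.1.1 τ.1.2 * Vᴴ τ.2.1 τ.2.2

theorem continuous_unitaryMonomial (τ : (d × d) × (d × d)) :
    Continuous fun V : Matrix d d ℂ => unitaryMonomial V τ :=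
  (continuous_id.matrix_elem _ _).mul (continuous_id.matrix_conjTranspose.matrix_elem _ _)

variable [Fintype d] [DecidableEq d] {V : Θ → Matrix.unitaryGroup d ℂ}

theorem norm_unitaryMonomial_le_one (V : Matrix.unitaryGroup d ℂ) (τ : (d × d) × (d × d)) :
    ‖unitaryMonomial (V : Matrix d d ℂ) τ‖ ≤ 1 := by
  rw [unitaryMonomial, norm_mul, Matrix.conjTranspose_apply, norm_star]
  exact mul_le_one₀ (entry_norm_bound_of_unitary V.2 _ _) (norm_nonneg _)
    (entry_norm_bound_of_unitary V.2 _ _)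

theorem integrable_unitaryMonomial_mul [IsFiniteMeasure μ] (hV : Measurable V)
    (τ τ' : (d × d) × (d × d)) :
    Integrable (fun θ => unitaryMonomial (V θ : Matrix d d ℂ) τ * unitaryMonomial (V θ) τ') μ := by
  refine Integrable.of_bound (C := 1) ?_ (.of_forall fun θ => ?_)
  · exact ((((continuous_unitaryMonomial τ).mul (continuous_unitaryMonomial τ')).comp
      continuous_subtype_val).measurable.comp hV).aestronglyMeasurable
  · rw [norm_mul]
    exact mul_le_one₀ (norm_unitaryMonomial_le_one _ τ) (norm_nonneg _)
      (norm_unitaryMonomial_le_one _ τ')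

theorem IsUnitaryDesign.integral_unitaryMonomial_mul (hV : IsUnitaryDesign 2 μ V)
    (τ τ' : (d × d) × (d × d)) :
    ∫ θ, unitaryMonomial (V θ : Matrix d d ℂ) τ * unitaryMonomial (V θ) τ' ∂μ =
      ∫ W : Matrix.unitaryGroup d ℂ, unitaryMonomial (W : Matrix d d ℂ) τ * unitaryMonomial W τ'
        ∂haarUnitary d := by
  simpa [Fin.prod_univ_two, unitaryMonomial] using
    hV ![τ.1.1, τ'.1.1] ![τ.1.2, τ'.1.2] ![τ.2.1, τ'.2.1] ![τ.2.2, τ'.2.2]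

theorem apply_eq_sum_single (β : Matrix d d ℂ →ₗ[ℂ] Matrix d d ℂ →ₗ[ℂ] ℂ) (A B : Matrix d d ℂ) :
    β A B = ∑ a : d × d, ∑ b : d × d,
      A a.1 a.2 * B b.1 b.2 * β (Matrix.single a.1 a.2 1) (Matrix.single b.1 b.2 1) := by
  have hexpand (A : Matrix d d ℂ) : A = ∑ a : d × d, A a.1 a.2 • Matrix.single a.1 a.2 1 := by
    rw [Fintype.sum_prod_type]
    simpa [Matrix.smul_single] using Matrix.matrix_eq_sum_single A
  conv_lhs => rw [hexpand A, hexpand B]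
  simp only [map_sum, map_smul, LinearMap.sum_apply, LinearMap.smul_apply, smul_eq_mul,
    Finset.mul_sum]
  rw [Finset.sum_comm]
  exact Finset.sum_congr rfl fun a _ => Finset.sum_congr rfl fun b _ => by ring

theorem apply_conjTranspose_eq_sum (β : Matrix d d ℂ →ₗ[ℂ] Matrix d d ℂ →ₗ[ℂ] ℂ)
    (V : Matrix d d ℂ) :
    β V Vᴴ = ∑ τ : (d × d) × (d × d), unitaryMonomial V τ *
      β (Matrix.single τ.1.1 τ.1.2 1) (Matrix.single τ.2.1 τ.2.2 1) := by
  rw [apply_eq_sum_single, Fintype.sum_prod_type (f := fun τ : (d × d) × (d × d) => _ * _)]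
  rfl

theorem integral_bilin_mul_bilin [IsFiniteMeasure μ] (hV : Measurable V)
    (β β' : Matrix d d ℂ →ₗ[ℂ] Matrix d d ℂ →ₗ[ℂ] ℂ) :
    ∫ θ, β (V θ) (V θ : Matrix d d ℂ)ᴴ * β' (V θ) (V θ : Matrix d d ℂ)ᴴ ∂μ =
      ∑ τ : (d × d) × (d × d), ∑ τ' : (d × d) × (d × d),
        (∫ θ, unitaryMonomial (V θ : Matrix d d ℂ) τ * unitaryMonomial (V θ) τ' ∂μ) *
          (β (Matrix.single τ.1.1 τ.1.2 1) (Matrix.single τ.2.1 τ.2.2 1) *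
            β' (Matrix.single τ'.1.1 τ'.1.2 1) (Matrix.single τ'.2.1 τ'.2.2 1)) := by
  have hint (τ τ' : (d × d) × (d × d)) (z : ℂ) :=
    (integrable_unitaryMonomial_mul (μ := μ) hV τ τ').mul_const z
  simp only [apply_conjTranspose_eq_sum, Finset.sum_mul_sum]
  simp only [mul_mul_mul_comm (unitaryMonomial _ _)]
  rw [integral_sum_sum fun τ τ' => hint τ τ' _]
  simp only [integral_mul_const]

theorem IsUnitaryDesign.integral_bilin_mul_bilin [IsFiniteMeasure μ] (hV : Measurable V)
    (hdesign : IsUnitaryDesign 2 μ V) (β β' : Matrix d d ℂ →ₗ[ℂ] Matrix d d ℂ →ₗ[ℂ] ℂ) :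
    ∫ θ, β (V θ) (V θ : Matrix d d ℂ)ᴴ * β' (V θ) (V θ : Matrix d d ℂ)ᴴ ∂μ =
      ∫ W : Matrix.unitaryGroup d ℂ, β W (W : Matrix d d ℂ)ᴴ * β' W (W : Matrix d d ℂ)ᴴ
        ∂haarUnitary d := by
  rw [_root_.integral_bilin_mul_bilin hV,
    _root_.integral_bilin_mul_bilin (V := fun W => W) measurable_id]
  simp only [hdesign.integral_unitaryMonomial_mul]

end UnitaryDesign

section LocalDesign

open PauliString
open scoped Matrix

variable {N : ℕ} {Θ : Type*} {mΘ : MeasurableSpace Θ} {s : Finset (Fin N)} {μ : Measure Θ}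
  {t : ℕ} {B : Θ → QOp N}

variable (s) in
/-- The bilinear form in `V` and `V†` whose value is the Pauli transfer matrix entry of `V ⊗ I`. -/
noncomputable def transferForm (P Q : PauliString N) :
    Matrix (s → Fin 2) (s → Fin 2) ℂ →ₗ[ℂ] Matrix (s → Fin 2) (s → Fin 2) ℂ →ₗ[ℂ] ℂ :=
  LinearMap.mk₂ ℂ
    (fun V V' => (2 ^ N : ℂ)⁻¹ * (Q.toOp * (embedHom s V' * P.toOp * embedHom s V)).trace)
    (by intros; simp only [map_add, mul_add, Matrix.trace_add])
    (by intros; simp only [map_smul, Matrix.mul_smul, Matrix.trace_smul, smul_eq_mul]; ring)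
    (by intros; simp only [map_add, mul_add, add_mul, Matrix.trace_add])
    (by intros; simp only [map_smul, Matrix.mul_smul, Matrix.smul_mul, Matrix.trace_smul,
          smul_eq_mul]; ring)

theorem ofReal_transfer_localUnitary (W : Matrix.unitaryGroup (s → Fin 2) ℂ)
    (P Q : PauliString N) : (transfer (localUnitary s W) P Q : ℂ) =
      transferForm s P Q W (W : Matrix (s → Fin 2) (s → Fin 2) ℂ)ᴴ := by
  rw [transfer, ofReal_coeff Q (heisenberg_isHermitian _ P.toOp_isHermitian), heisenberg_apply,
    transferForm, LinearMap.mk₂_apply, ← Matrix.star_eq_conjTranspose,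
    ← Matrix.star_eq_conjTranspose, map_star (embedHom s)]
  rfl

namespace IsLocalDesign

theorem exists_eq_localUnitary (hB : IsLocalDesign t μ s B) :
    ∃ V : Θ → Matrix.unitaryGroup (s → Fin 2) ℂ,
      Measurable V ∧ (B = fun θ => (localUnitary s (V θ) : QOp N)) ∧ IsUnitaryDesign t μ V := by
  obtain ⟨V, hV, hBV, hdesign⟩ := hB
  exact ⟨V, hV, funext hBV, hdesign⟩

theorem isRandomUnitary (hB : IsLocalDesign t μ s B) : IsRandomUnitary mΘ B := by
  obtain ⟨V, hV, rfl, -⟩ := hB.exists_eq_localUnitary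
  exact .localUnitary hV

theorem integral_transfer_mul_transfer [IsFiniteMeasure μ] (hB : IsLocalDesign 2 μ s B)
    (P P' Q Q' : PauliString N) :
    ∫ θ, transfer (B θ) P Q * transfer (B θ) P' Q' ∂μ = twirl s P P' Q Q' := by
  obtain ⟨V, hV, rfl, hdesign⟩ := hB.exists_eq_localUnitary
  rw [← Complex.ofReal_inj, twirl, ← integral_complex_ofReal, ← integral_complex_ofReal]
  simp only [Complex.ofReal_mul, ofReal_transfer_localUnitary]
  exact hdesign.integral_bilin_mul_bilin hV _ _

end IsLocalDesign

end LocalDesign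

/-! ### Random observables and their second moments -/

section RandomObservable

open PauliString

variable {N : ℕ} {Θ : Type*}

/-- A random Hermitian operator with bounded Pauli coefficients that is measurable with respect to
`m`. -/
structure IsRandomObservable (m : MeasurableSpace Θ) (A : Θ → QOp N) : Prop where
  isHermitian : ∀ θ, (A θ).IsHermitian
  measurable : Measurable[m] A
  exists_abs_coeff_le : ∃ C, ∀ θ P, |coeff P (A θ)| ≤ C

namespace IsRandomObservable

variable {m mΘ : MeasurableSpace Θ} {A B : Θ → QOp N}

theorem const (m : MeasurableSpace Θ) {A : QOp N} (hA : A.IsHermitian) :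
    IsRandomObservable m fun _ : Θ => A where
  isHermitian _ := hA
  measurable := measurable_const
  exists_abs_coeff_le := ⟨∑ P, |coeff P A|, fun _ P => Finset.single_le_sum
    (f := fun P => |coeff P A|) (fun _ _ => abs_nonneg _) (Finset.mem_univ P)⟩

theorem mono (hA : IsRandomObservable m A) (hm : m ≤ mΘ) : IsRandomObservable mΘ A :=
  ⟨hA.isHermitian, hA.measurable.mono hm le_rfl, hA.exists_abs_coeff_le⟩

theorem heisenberg (hA : IsRandomObservable m A) (hB : IsRandomUnitary m B) :
    IsRandomObservable m fun θ => heisenberg (B θ) (A θ) where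
  isHermitian θ := heisenberg_isHermitian _ (hA.isHermitian θ)
  measurable := by
    have hcont : Continuous fun p : QOp N × QOp N => _root_.heisenberg p.1 p.2 := by
      simp only [heisenberg_apply]
      fun_prop
    have hmeas : Measurable[m] fun θ => (B θ, A θ) := hB.measurable.prodMk hA.measurable
    have hcomp := hcont.measurable.comp hmeas
    exact hcomp
  exists_abs_coeff_le := by
    obtain ⟨C, hC⟩ := hA.exists_abs_coeff_le
    refine ⟨∑ _P : PauliString N, C, fun θ Q => ?_⟩
    rw [coeff_heisenberg _ (hA.isHermitian θ)]
    refine (Finset.abs_sum_le_sum_abs _ _).trans (Finset.sum_le_sum fun P _ => ?_)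
    rw [abs_mul]
    exact (mul_le_of_le_one_right (abs_nonneg _) (hB.abs_transfer_le_one P Q θ)).trans (hC θ P)

theorem commutator (hA : IsRandomObservable m A) (P : PauliString N) :
    IsRandomObservable m fun θ => commutator P (A θ) where
  isHermitian θ := commutator_isHermitian P (hA.isHermitian θ)
  measurable := by
    have hcont : Continuous (PauliString.commutator P) := by
      unfold PauliString.commutator
      fun_prop
    exact hcont.measurable.comp hA.measurable
  exists_abs_coeff_le := by
    obtain ⟨C, hC⟩ := hA.exists_abs_coeff_le
    refine ⟨2 * C, fun θ Q => ?_⟩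
    have hle : |structConst Q P| ≤ 2 := by
      refine abs_le_of_sq_le_sq ?_ zero_le_two
      rw [structConst_sq]
      split_ifs <;> norm_num
    rw [coeff_commutator, abs_mul]
    exact mul_le_mul hle (hC θ _) (abs_nonneg _) zero_le_two

theorem integrable_coeff (hA : IsRandomObservable mΘ A) (μ : Measure Θ) [IsFiniteMeasure μ]
    (Q : PauliString N) : Integrable (fun θ => coeff Q (A θ)) μ := by
  obtain ⟨C, hC⟩ := hA.exists_abs_coeff_le
  exact .of_bound ((continuous_coeff Q).measurable.comp hA.measurable).aestronglyMeasurable C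
    (.of_forall fun θ => hC θ Q)

theorem integrable_coeff_mul_coeff (hA : IsRandomObservable mΘ A) (μ : Measure Θ)
    [IsFiniteMeasure μ] (Q Q' : PauliString N) :
    Integrable (fun θ => coeff Q (A θ) * coeff Q' (A θ)) μ := by
  obtain ⟨C, hC⟩ := hA.exists_abs_coeff_le
  exact (hA.integrable_coeff μ Q').bdd_mul
    ((continuous_coeff Q).measurable.comp hA.measurable).aestronglyMeasurable
    (.of_forall fun θ => hC θ Q)

theorem integral_coeff_heisenberg {μ : Measure Θ} [IsFiniteMeasure μ]
    (hA : IsRandomObservable mΘ A) (hB : IsRandomUnitary mΘ B) (hind : IndepFun A B μ)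
    (Q : PauliString N) : ∫ θ, coeff Q (_root_.heisenberg (B θ) (A θ)) ∂μ =
      ∑ P, (∫ θ, coeff P (A θ) ∂μ) * ∫ θ, transfer (B θ) P Q ∂μ := by
  have hindP (P : PauliString N) :
      IndepFun (fun θ => coeff P (A θ)) (fun θ => transfer (B θ) P Q) μ :=
    hind.comp (φ := coeff P) (ψ := fun B => transfer B P Q) (continuous_coeff P).measurable
      (continuous_transfer P Q).measurable
  have hint (P : PauliString N) :=
    (hindP P).integrable_mul (hA.integrable_coeff μ P) (hB.integrable_transfer μ P Q)
  simp only [coeff_heisenberg _ (hA.isHermitian _)]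
  refine (integral_finsetSum _ fun P _ => hint P).trans <| Finset.sum_congr rfl fun P _ =>
    (hindP P).integral_fun_mul_eq_mul_integral
    (hA.integrable_coeff μ P).aestronglyMeasurable
    (hB.integrable_transfer μ P Q).aestronglyMeasurable

end IsRandomObservable

/-- The second moments `𝔼 (a_Q a_Q')` of the Pauli coefficients `a_Q` of a random operator. -/
noncomputable def secondMoment {_ : MeasurableSpace Θ} (μ : Measure Θ) (A : Θ → QOp N)
    (Q Q' : PauliString N) : ℝ :=
  ∫ θ, coeff Q (A θ) * coeff Q' (A θ) ∂μ

/-- The second moments obtained from `M` by conjugation with an independent local `2`-design on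
`s`. -/
noncomputable def twirlMoment (s : Finset (Fin N)) (M : PauliString N → PauliString N → ℝ)
    (Q Q' : PauliString N) : ℝ :=
  ∑ P, ∑ P', M P P' * twirl s P P' Q Q'

/-- The second moments obtained from `M` by taking the commutator with the Pauli string `g`. -/
noncomputable def commutatorMoment (g : PauliString N) (M : PauliString N → PauliString N → ℝ)
    (Q Q' : PauliString N) : ℝ :=
  structConst Q g * structConst Q' g * M (Q * g) (Q' * g)

variable {mΘ : MeasurableSpace Θ} {μ : Measure Θ} {s : Finset (Fin N)} {A B : Θ → QOp N}

theorem integral_coeff_commutator (μ : Measure Θ) (g : PauliString N) (A : Θ → QOp N)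
    (Q : PauliString N) : ∫ θ, coeff Q (commutator g (A θ)) ∂μ =
      structConst Q g * ∫ θ, coeff (Q * g) (A θ) ∂μ := by
  simp only [coeff_commutator, integral_const_mul]

theorem secondMoment_commutator (μ : Measure Θ) (g : PauliString N) (A : Θ → QOp N) :
    secondMoment μ (fun θ => commutator g (A θ)) = commutatorMoment g (secondMoment μ A) := by
  funext Q Q'
  simp only [secondMoment, commutatorMoment, coeff_commutator, ← integral_const_mul]
  exact integral_congr_ae (.of_forall fun θ => mul_mul_mul_comm _ _ _ _)

theorem IsRandomObservable.secondMoment_heisenberg [IsFiniteMeasure μ]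
    (hA : IsRandomObservable mΘ A) (hB : IsRandomUnitary mΘ B) (hind : IndepFun A B μ)
    (Q Q' : PauliString N) : secondMoment μ (fun θ => _root_.heisenberg (B θ) (A θ)) Q Q' =
      ∑ P, ∑ P', secondMoment μ A P P' * ∫ θ, transfer (B θ) P Q * transfer (B θ) P' Q' ∂μ := by
  have hindP (P P' : PauliString N) : IndepFun (fun θ => coeff P (A θ) * coeff P' (A θ))
      (fun θ => transfer (B θ) P Q * transfer (B θ) P' Q') μ :=
    hind.comp (φ := fun A => coeff P A * coeff P' A)
      (ψ := fun B => transfer B P Q * transfer B P' Q')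
      ((continuous_coeff P).mul (continuous_coeff P')).measurable
      ((continuous_transfer P Q).mul (continuous_transfer P' Q')).measurable
  have hint (P P' : PauliString N) := (hindP P P').integrable_mul
    (hA.integrable_coeff_mul_coeff μ P P') (hB.integrable_transfer_mul_transfer μ P P' Q Q')
  simp only [secondMoment, coeff_heisenberg_mul_coeff_heisenberg _ (hA.isHermitian _)]
  refine (integral_sum_sum hint).trans <| Finset.sum_congr rfl fun P _ =>
    Finset.sum_congr rfl fun P' _ => (hindP P P').integral_fun_mul_eq_mul_integral
    (hA.integrable_coeff_mul_coeff μ P P').aestronglyMeasurable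
    (hB.integrable_transfer_mul_transfer μ P P' Q Q').aestronglyMeasurable

theorem IsLocalDesign.secondMoment_heisenberg [IsFiniteMeasure μ] (hB : IsLocalDesign 2 μ s B)
    (hA : IsRandomObservable mΘ A) (hind : IndepFun A B μ) :
    secondMoment μ (fun θ => heisenberg (B θ) (A θ)) = twirlMoment s (secondMoment μ A) := by
  funext Q Q'
  rw [hA.secondMoment_heisenberg hB.isRandomUnitary hind]
  simp only [hB.integral_transfer_mul_transfer, twirlMoment]

theorem IsRandomObservable.twirlMoment_secondMoment [IsFiniteMeasure μ]
    (hA : IsRandomObservable mΘ A) (Q Q' : PauliString N) :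
    twirlMoment s (secondMoment μ A) Q Q' =
      ∫ θ, ∑ P, ∑ P', coeff P (A θ) * coeff P' (A θ) * twirl s P P' Q Q' ∂μ := by
  have hint (P P' : PauliString N) :=
    (hA.integrable_coeff_mul_coeff μ P P').mul_const (twirl s P P' Q Q')
  simp only [integral_sum_sum hint, integral_mul_const, twirlMoment, secondMoment]

/- Invariance of the Haar measure absorbs the gate `W`. -/
theorem IsRandomObservable.twirlMoment_secondMoment_heisenberg [IsFiniteMeasure μ]
    (hA : IsRandomObservable mΘ A) {W : Θ → Matrix.unitaryGroup (s → Fin 2) ℂ}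
    (hW : Measurable W) :
    twirlMoment s (secondMoment μ fun θ => _root_.heisenberg (localUnitary s (W θ)) (A θ)) =
      twirlMoment s (secondMoment μ A) := by
  funext Q Q'
  rw [(hA.heisenberg (.localUnitary hW)).twirlMoment_secondMoment, hA.twirlMoment_secondMoment]
  simp only [sum_coeff_heisenberg_mul_twirl _ (hA.isHermitian _)]

theorem IsLocalDesign.integral_transfer_eq_zero [IsFiniteMeasure μ] (hB : IsLocalDesign 2 μ s B)
    (P : PauliString N) {Q : PauliString N} (hQ : ¬ Disjoint Q.support s) :
    ∫ θ, transfer (B θ) P Q ∂μ = 0 := by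
  have hone (θ : Θ) : transfer (B θ) (1 : PauliString N) 1 = 1 := by
    obtain ⟨V, -, rfl, -⟩ := hB.exists_eq_localUnitary
    simp [transfer_localUnitary_of_disjoint_left (P := 1) (s := s)
      (Finset.disjoint_left.2 fun _ hq => absurd rfl (mem_support.1 hq))]
  have htwirl := hB.integral_transfer_mul_transfer P 1 Q 1
  rwa [twirl_eq_zero_of_not_disjoint_right (by rwa [mul_one]), integral_congr_ae
    (.of_forall fun θ => by rw [hone, mul_one])] at htwirl

end RandomObservable

/-! ### Propagation of lower bounds on second moments -/

namespace PauliString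

variable {N : ℕ} {s : Finset (Fin N)}

open Classical in
/-- The string `h` with its non-trivial entries on the qubits in `c` replaced by `Z`. The expected
value of `collapseZ c h` in the state `|0⋯0⟩` does not vanish once `c` contains the support. -/
noncomputable def collapseZ (c : Set (Fin N)) (h : PauliString N) : PauliString N :=
  fun q => if q ∈ c ∧ h q ≠ 1 then .Z else h q

theorem support_collapseZ (c : Set (Fin N)) (h : PauliString N) :
    (collapseZ c h).support = h.support := by
  ext q
  rw [mem_support, mem_support, collapseZ]
  split_ifs with hq
  · exact iff_of_true (by decide) hq.2
  · rfl

theorem collapseZ_union_apply (c : Set (Fin N)) (h : PauliString N) {q : Fin N} (hq : q ∉ s) :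
    collapseZ (c ∪ s) h q = collapseZ c h q := by
  by_cases hc : q ∈ c <;> simp [collapseZ, hq, hc]

theorem support_collapseZ_mul_collapseZ_union_subset (c : Set (Fin N)) (h : PauliString N) :
    (collapseZ c h * collapseZ (c ∪ s) h).support ⊆ s := by
  intro q hq
  by_contra hqs
  exact mem_support_mul.1 hq (collapseZ_union_apply c h hqs).symm

theorem collapseZ_union_of_disjoint (c : Set (Fin N)) {h : PauliString N}
    (hs : Disjoint h.support s) : collapseZ (c ∪ s) h = collapseZ c h := by
  funext q
  by_cases hqs : q ∈ s
  · simp [collapseZ, notMem_support.1 (Finset.disjoint_right.1 hs hqs)]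
  · exact collapseZ_union_apply c h hqs

theorem sign_eq_one_of_disjoint {P Q : PauliString N} (h : Disjoint P.support Q.support) :
    sign P Q = 1 := by
  refine Finset.prod_eq_one fun q _ => ?_
  by_cases hq : q ∈ P.support
  · simp [notMem_support.1 (Finset.disjoint_left.1 h hq), Pauli.sign]
  · simp [notMem_support.1 hq, Pauli.sign]

theorem not_disjoint_support_of_sign {P Q : PauliString N} (hQ : Q.support ⊆ s)
    (h : sign P Q = -1) : ¬ Disjoint P.support s := fun hdisj => by
  rw [sign_eq_one_of_disjoint (hdisj.mono_right hQ)] at h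
  exact absurd h (by decide)

/- Multiplication by a string on `s` that anticommutes with `g` exchanges the two halves. -/
theorem two_mul_card_filter_sign {g : PauliString N} (hg : ¬ Disjoint g.support s)
    (P : PauliString N) :
    2 * ((agreeOutside s P).filter fun R => sign R g = -1).card = 4 ^ s.card := by
  obtain ⟨D, hD, hsign⟩ := exists_sign_eq_neg_one hg
  have hflip (R : PauliString N) : sign (R * D) g = -sign R g := by
    rw [sign_mul_left, sign_comm D, hsign, mul_neg_one]
  have hmem {R : PauliString N} (hR : R ∈ agreeOutside s P) : R * D ∈ agreeOutside s P := by
    rw [mem_agreeOutside, ← mul_assoc] at *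
    exact (support_mul_subset _ _).trans (Finset.union_subset hR hD)
  have hcard : ((agreeOutside s P).filter fun R => sign R g = -1).card =
      ((agreeOutside s P).filter fun R => ¬ sign R g = -1).card := by
    refine Finset.card_nbij' (· * D) (· * D) ?_ ?_ (fun R _ => mul_mul_cancel R D)
      (fun R _ => mul_mul_cancel R D) <;> intro R hR <;>
      simp only [Finset.coe_filter, Set.mem_ofPred_eq] at hR ⊢
    · exact ⟨hmem hR.1, by rw [hflip, hR.2]; decide⟩
    · exact ⟨hmem hR.1, by rw [hflip, (Int.units_eq_one_or _).resolve_right hR.2]⟩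
  rw [← card_agreeOutside s P, ← Finset.card_filter_add_card_filter_not (s := agreeOutside s P)
    fun R => sign R g = -1, ← hcard, two_mul]

end PauliString

section MomentBound

open PauliString

variable {N : ℕ} {s : Finset (Fin N)} {M : PauliString N → PauliString N → ℝ}

theorem eqOn_of_twirlMoment_ne_zero {c : Set (Fin N)}
    (hM : ∀ P P', M P P' ≠ 0 → Set.EqOn P P' c) {Q Q' : PauliString N}
    (h : twirlMoment s M Q Q' ≠ 0) : Set.EqOn Q Q' (c ∪ s) := by
  obtain ⟨P, -, hP⟩ := Finset.exists_ne_zero_of_sum_ne_zero h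
  obtain ⟨P', -, hP'⟩ := Finset.exists_ne_zero_of_sum_ne_zero hP
  exact fun q hq => eqOn_of_twirl_ne_zero (right_ne_zero_of_mul hP') fun hqs =>
    hM P P' (left_ne_zero_of_mul hP') (hq.resolve_right hqs)

theorem sum_twirlMoment_diag_mul (s : Finset (Fin N)) (M : PauliString N → PauliString N → ℝ)
    (f : PauliString N → ℝ) :
    ∑ Q, twirlMoment s M Q Q * f Q = ∑ P, M P P * ∑ Q, twirl s P P Q Q * f Q := by
  have hdiag (Q : PauliString N) : twirlMoment s M Q Q = ∑ P, M P P * twirl s P P Q Q :=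
    Finset.sum_congr rfl fun P _ => Fintype.sum_eq_single P fun P' hP' => by
      rw [twirl_diag_eq_zero hP'.symm, mul_zero]
  simp only [hdiag, Finset.sum_mul, Finset.mul_sum, mul_assoc]
  exact Finset.sum_comm

theorem sum_commutatorMoment_diag_mul (g : PauliString N)
    (M : PauliString N → PauliString N → ℝ) (f : PauliString N → ℝ) :
    ∑ Q, commutatorMoment g M Q Q * f Q = ∑ R, M R R * (structConst R g ^ 2 * f (R * g)) := by
  refine Fintype.sum_equiv (Equiv.mulRight g) _ _ fun Q => ?_
  have hsq : structConst (Q * g) g ^ 2 = structConst Q g ^ 2 := by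
    simp only [structConst_sq, sign_mul_left, sign_self, mul_one]
  rw [Equiv.coe_mulRight, hsq, mul_mul_cancel, commutatorMoment]
  ring

/-- The lower bound on the fraction of the weight of the string `h` that a local `2`-design on `s`
moves to any given string that is non-trivial on `s` and agrees with `h` elsewhere. -/
noncomputable def blockFactor (s : Finset (Fin N)) (h : PauliString N) : ℝ :=
  if Disjoint h.support s then 1 else (4 ^ s.card)⁻¹

theorem blockFactor_nonneg (s : Finset (Fin N)) (h : PauliString N) : 0 ≤ blockFactor s h := by
  unfold blockFactor
  split_ifs <;> positivity

theorem blockFactor_le_twirl (s : Finset (Fin N)) (c : Set (Fin N)) (h : PauliString N) :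
    blockFactor s h ≤
      twirl s (collapseZ c h) (collapseZ c h) (collapseZ (c ∪ s) h) (collapseZ (c ∪ s) h) := by
  unfold blockFactor
  split_ifs with hs
  · rw [collapseZ_union_of_disjoint c hs, twirl_self_of_disjoint (by rwa [support_collapseZ])]
  · exact inv_le_twirl (support_collapseZ_mul_collapseZ_union_subset c h)
      (by rwa [support_collapseZ]) (by rwa [support_collapseZ])

/- The `4 ^ |s| / 2` strings `R` on the way that anticommute with `g` each contribute at least
`4 ^ (-|s|) * 4 * 4 ^ (-|s|)`. -/
theorem two_mul_inv_le_sum_twirl_mul_twirl {g P Q : PauliString N} (hgs : g.support ⊆ s)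
    (hg : g.support.Nonempty) (hPQ : (P * Q).support ⊆ s) (hP : ¬ Disjoint P.support s)
    (hQ : ¬ Disjoint Q.support s) : 2 * (4 ^ s.card : ℝ)⁻¹ ≤
      ∑ R, twirl s P P R R * (structConst R g ^ 2 * twirl s (R * g) (R * g) Q Q) := by
  set S := (agreeOutside s P).filter fun R => sign R g = -1
  have hcard : 2 * (S.card : ℝ) = 4 ^ s.card := by
    have hgs' : ¬ Disjoint g.support s := fun hdisj =>
      hg.ne_empty (hdisj.eq_bot_of_le hgs)
    exact_mod_cast two_mul_card_filter_sign hgs' P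
  have hterm : ∀ R ∈ S, (4 ^ s.card : ℝ)⁻¹ * (4 * (4 ^ s.card : ℝ)⁻¹) ≤
      twirl s P P R R * (structConst R g ^ 2 * twirl s (R * g) (R * g) Q Q) := by
    intro R hR
    obtain ⟨hPR, hRg⟩ := Finset.mem_filter.1 hR
    rw [mem_agreeOutside] at hPR
    have hRQ : (R * g * Q).support ⊆ s := by
      rw [show R * g * Q = P * R * (P * Q) * g by
        rw [mul_mul_mul_comm, mul_self, one_mul, mul_right_comm]]
      exact (support_mul_subset _ _).trans (Finset.union_subset
        ((support_mul_subset _ _).trans (Finset.union_subset hPR hPQ)) hgs)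
    have hRg' : sign (R * g) g = -1 := by rw [sign_mul_left, sign_self, mul_one, hRg]
    rw [structConst_sq, if_pos hRg]
    gcongr
    · exact twirl_diag_nonneg s P R
    · exact inv_le_twirl hPR hP (not_disjoint_support_of_sign hgs hRg)
    · exact inv_le_twirl hRQ (not_disjoint_support_of_sign hgs hRg') hQ
  calc 2 * (4 ^ s.card : ℝ)⁻¹ = S.card • ((4 ^ s.card : ℝ)⁻¹ * (4 * (4 ^ s.card : ℝ)⁻¹)) := by
        rw [nsmul_eq_mul]
        field_simp
        linarith
    _ ≤ ∑ R ∈ S, twirl s P P R R * (structConst R g ^ 2 * twirl s (R * g) (R * g) Q Q) :=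
        Finset.card_nsmul_le_sum _ _ _ hterm
    _ ≤ _ := Finset.sum_le_sum_of_subset_of_nonneg (Finset.subset_univ S) fun R _ _ =>
        mul_nonneg (twirl_diag_nonneg s P R) (mul_nonneg (sq_nonneg _) (twirl_diag_nonneg s _ Q))

/-- Second moments `M` that couple only strings agreeing on `c` and whose diagonal dominates, in the
sense of sums against nonnegative functions, the weights `w h` placed on the strings
`collapseZ c h`. -/
structure MomentBound (F : Finset (PauliString N)) (c : Set (Fin N)) (w : PauliString N → ℝ)
    (M : PauliString N → PauliString N → ℝ) : Prop where
  eqOn : ∀ Q Q', M Q Q' ≠ 0 → Set.EqOn Q Q' c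
  nonneg : ∀ h, 0 ≤ w h
  sum_le : ∀ f : PauliString N → ℝ, (∀ Q, 0 ≤ f Q) →
    ∑ h ∈ F, w h * f (collapseZ c h) ≤ ∑ Q, M Q Q * f Q

namespace MomentBound

variable {F : Finset (PauliString N)} {c : Set (Fin N)} {w : PauliString N → ℝ}

theorem sum_le_of_kernel (hM : MomentBound F c w M) {c' : Set (Fin N)} {v : PauliString N → ℝ}
    {K : PauliString N → PauliString N → ℝ} (hK : ∀ P Q, 0 ≤ K P Q)
    (hle : ∀ h ∈ F, v h ≤ K (collapseZ c h) (collapseZ c' h)) {f : PauliString N → ℝ}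
    (hf : ∀ Q, 0 ≤ f Q) :
    ∑ h ∈ F, w h * v h * f (collapseZ c' h) ≤ ∑ P, M P P * ∑ Q, K P Q * f Q := by
  refine le_trans (Finset.sum_le_sum fun h hh => ?_)
    (hM.sum_le _ fun P => Finset.sum_nonneg fun Q _ => mul_nonneg (hK P Q) (hf Q))
  rw [mul_assoc]
  refine mul_le_mul_of_nonneg_left ?_ (hM.nonneg h)
  exact (mul_le_mul_of_nonneg_right (hle h hh) (hf _)).trans <| Finset.single_le_sum
    (f := fun Q => K (collapseZ c h) Q * f Q) (fun Q _ => mul_nonneg (hK _ Q) (hf Q))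
    (Finset.mem_univ _)

theorem twirlMoment (hM : MomentBound F c w M) (s : Finset (Fin N)) :
    MomentBound F (c ∪ s) (fun h => w h * blockFactor s h) (twirlMoment s M) where
  eqOn _ _ := eqOn_of_twirlMoment_ne_zero hM.eqOn
  nonneg h := mul_nonneg (hM.nonneg h) (blockFactor_nonneg s h)
  sum_le f hf := by
    rw [sum_twirlMoment_diag_mul]
    exact hM.sum_le_of_kernel (fun P Q => twirl_diag_nonneg s P Q)
      (fun h _ => blockFactor_le_twirl s c h) hf

theorem twirlMoment_commutatorMoment (hM : MomentBound F c w M) {g : PauliString N}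
    (hgs : g.support ⊆ s) (hg : g.support.Nonempty) (hF : ∀ h ∈ F, ¬ Disjoint h.support s) :
    MomentBound F (c ∪ s) (fun h => w h * (2 * (4 ^ s.card : ℝ)⁻¹))
      (_root_.twirlMoment s (commutatorMoment g (_root_.twirlMoment s M))) where
  eqOn Q Q' h := by
    rw [← Set.union_self (s : Set (Fin N)), ← Set.union_assoc]
    refine eqOn_of_twirlMoment_ne_zero (fun P P' hP q hq => ?_) h
    exact mul_right_cancel
      (eqOn_of_twirlMoment_ne_zero hM.eqOn (right_ne_zero_of_mul hP) hq : (P * g) q = (P' * g) q)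
  nonneg h := mul_nonneg (hM.nonneg h) (by positivity)
  sum_le f hf := by
    rw [sum_twirlMoment_diag_mul, sum_commutatorMoment_diag_mul, sum_twirlMoment_diag_mul]
    have hswap (P : PauliString N) :
        ∑ R, twirl s P P R R * (structConst R g ^ 2 * ∑ Q, twirl s (R * g) (R * g) Q Q * f Q) =
          ∑ Q, (∑ R, twirl s P P R R * (structConst R g ^ 2 * twirl s (R * g) (R * g) Q Q)) *
            f Q := by
      simp only [Finset.mul_sum, Finset.sum_mul, mul_assoc]
      exact Finset.sum_comm
    simp only [hswap]
    refine hM.sum_le_of_kernel (fun P Q => Finset.sum_nonneg fun R _ => mul_nonneg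
      (twirl_diag_nonneg s P R) (mul_nonneg (sq_nonneg _) (twirl_diag_nonneg s _ Q)))
      (fun h hh => ?_) hf
    exact two_mul_inv_le_sum_twirl_mul_twirl hgs hg
      (support_collapseZ_mul_collapseZ_union_subset c h)
      (by rw [support_collapseZ]; exact hF h hh) (by rw [support_collapseZ]; exact hF h hh)

end MomentBound

end MomentBound

/-! ### Rotations -/

section Rotation

open scoped Matrix

variable {n : Type*} [Fintype n] [DecidableEq n] {N : ℕ} {s : Finset (Fin N)}

/-- The one-parameter group `exp(-i t G)` generated by `G`. -/
noncomputable def expRotation (G : Matrix n n ℂ) (t : ℝ) : Matrix n n ℂ :=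
  NormedSpace.exp ((-(Complex.I * (t : ℂ))) • G)

theorem expRotation_eq_exp_smul (G : Matrix n n ℂ) (t : ℝ) :
    expRotation G t = NormedSpace.exp (t • -(Complex.I • G)) := by
  rw [expRotation, ← Complex.coe_smul, ← neg_smul, smul_smul, mul_neg, mul_comm]

open scoped Matrix.Norms.Operator in
theorem hasDerivAt_expRotation (G : Matrix n n ℂ) (t : ℝ) :
    HasDerivAt (expRotation G) (expRotation G t * -(Complex.I • G)) t := by
  rw [funext (expRotation_eq_exp_smul G)]
  exact hasDerivAt_exp_smul_const _ t

open scoped Matrix.Norms.Operator in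
theorem continuous_expRotation (G : Matrix n n ℂ) : Continuous (expRotation G) :=
  continuous_iff_continuousAt.2 fun t => (hasDerivAt_expRotation G t).continuousAt

theorem conjTranspose_expRotation {G : Matrix n n ℂ} (hG : G.IsHermitian) (t : ℝ) :
    (expRotation G t)ᴴ = expRotation G (-t) := by
  rw [expRotation, ← Matrix.exp_conjTranspose, Matrix.conjTranspose_smul, hG.eq, expRotation]
  simp

theorem commute_expRotation (G : Matrix n n ℂ) (t : ℝ) : Commute G (expRotation G t) :=
  ((Commute.refl G).smul_right _).exp_right

theorem expRotation_mem_unitaryGroup {G : Matrix n n ℂ} (hG : G.IsHermitian) (t : ℝ) :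
    expRotation G t ∈ Matrix.unitaryGroup n ℂ := by
  have hcomm : Commute (t • -(Complex.I • G)) (-t • -(Complex.I • G)) :=
    ((Commute.refl _).smul_left t).smul_right (-t)
  rw [Matrix.mem_unitaryGroup_iff, Matrix.star_eq_conjTranspose, conjTranspose_expRotation hG,
    expRotation_eq_exp_smul, expRotation_eq_exp_smul, ← Matrix.exp_add_of_commute _ _ hcomm,
    neg_smul, add_neg_cancel, NormedSpace.exp_zero]

open scoped Matrix.Norms.Operator in
theorem embedHom_expRotation (s : Finset (Fin N)) (G : Matrix (s → Fin 2) (s → Fin 2) ℂ) (t : ℝ) :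
    embedHom s (expRotation G t) = expRotation (embedHom s G) t := by
  refine (NormedSpace.map_exp (embedHom s) (continuous_embedHom s) _).trans ?_
  rw [map_smul]
  rfl

theorem exists_localUnitary_eq_expRotation {G : QOp N} (hG : G.IsHermitian)
    (hGs : G ∈ (embedHom s).range) :
    ∃ W : ℝ → Matrix.unitaryGroup (s → Fin 2) ℂ, Continuous W ∧
      ∀ t, (localUnitary s (W t) : QOp N) = expRotation G t := by
  obtain ⟨K, rfl⟩ := hGs
  have hK : K.IsHermitian := embedHom_injective s ((map_star (embedHom s) K).trans hG)
  exact ⟨fun t => ⟨expRotation K t, expRotation_mem_unitaryGroup hK t⟩,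
    (continuous_expRotation K).subtype_mk _, fun t => embedHom_expRotation s K t⟩

open scoped Matrix.Norms.Operator in
theorem hasDerivAt_heisenberg_expRotation (P : PauliString N) (A : QOp N) (t : ℝ) :
    HasDerivAt (fun t => heisenberg (expRotation P.toOp t) A)
      (heisenberg (expRotation P.toOp t) (P.commutator A)) t := by
  have hneg : HasDerivAt (fun t => (expRotation P.toOp t)ᴴ) ((expRotation P.toOp t)ᴴ *
      (Complex.I • P.toOp)) t := by
    simp only [conjTranspose_expRotation P.toOp_isHermitian]
    refine ((hasDerivAt_expRotation P.toOp (-t)).scomp t (hasDerivAt_neg t)).congr_deriv ?_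
    simp
  refine ((hneg.mul_const A).mul (hasDerivAt_expRotation P.toOp t)).congr_deriv ?_
  simp only [heisenberg_apply, PauliString.commutator, Matrix.mul_smul, Matrix.smul_mul, mul_neg,
    mul_sub, sub_mul, smul_sub, mul_assoc, (commute_expRotation P.toOp t).eq]
  exact (sub_eq_add_neg _ _).symm

open scoped Matrix.Norms.Operator in
theorem hasDerivAt_linearMap_heisenberg_expRotation (L : QOp N →ₗ[ℝ] ℝ) (P : PauliString N)
    (A : QOp N) (t : ℝ) :
    HasDerivAt (fun t => L (heisenberg (expRotation P.toOp t) A))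
      (L (heisenberg (expRotation P.toOp t) (P.commutator A))) t :=
  (LinearMap.toContinuousLinearMap L).hasFDerivAt.comp_hasDerivAt t
    (hasDerivAt_heisenberg_expRotation P A t)

end Rotation

/-! ### The circuit as a product of segments -/

/-- The expected value `⟨0⋯0|A|0⋯0⟩` of an observable. -/
noncomputable def zeroStateExpectation {N : ℕ} : QOp N →ₗ[ℝ] ℝ where
  toFun A := (A 0 0).re
  map_add' _ _ := rfl
  map_smul' r A := Complex.re_ofReal_mul r (A 0 0)

namespace VQE

variable (V : VQE)

theorem pairwise_filter_reverse_finRange {n : ℕ} (p : Fin n → Bool) :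
    ((List.finRange n).reverse.filter p).Pairwise (· > ·) :=
  (List.pairwise_reverse.2 (List.pairwise_lt_finRange n)).filter p

theorem gateProd_eq_prod_map {l : List (Fin V.numGates)} {S : Finset (Fin V.numGates)}
    (hl : l.Pairwise (· > ·)) (hS : ∀ ν, ν ∈ l ↔ ν ∈ S) (θ : Fin V.numGates → ℝ) :
    V.gateProd S θ = (l.map fun ν => V.gate ν (θ ν)).prod := by
  rw [gateProd, (pairwise_filter_reverse_finRange _).eq_of_mem_iff hl fun ν => by simp [hS]]

theorem gateProd_empty (θ : Fin V.numGates → ℝ) : V.gateProd ∅ θ = 1 := by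
  simp [gateProd]

theorem gateProd_singleton (ν : Fin V.numGates) (θ : Fin V.numGates → ℝ) :
    V.gateProd {ν} θ = V.gate ν (θ ν) := by
  rw [V.gateProd_eq_prod_map (List.pairwise_singleton _ ν) (by simp), List.map_singleton,
    List.prod_singleton]

theorem gateProd_union {S T : Finset (Fin V.numGates)} (h : ∀ a ∈ S, ∀ b ∈ T, a < b)
    (θ : Fin V.numGates → ℝ) : V.gateProd (S ∪ T) θ = V.gateProd T θ * V.gateProd S θ := by
  have happ := List.pairwise_append.2 ⟨pairwise_filter_reverse_finRange (· ∈ T),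
    pairwise_filter_reverse_finRange (· ∈ S), fun b hb a ha =>
      h a (by simpa using ha) b (by simpa using hb)⟩
  rw [V.gateProd_eq_prod_map happ (by simp [or_comm]), List.map_append, List.prod_append]
  rfl

theorem gateProd_congr {S : Finset (Fin V.numGates)} {θ θ' : Fin V.numGates → ℝ}
    (h : ∀ ν ∈ S, θ ν = θ' ν) : V.gateProd S θ = V.gateProd S θ' := by
  refine congrArg List.prod (List.map_congr_left fun ν hν => ?_)
  rw [h ν (by simpa using hν)]

theorem gateProd_eq_prod_segmentUnitary (θ : Fin V.numGates → ℝ) :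
    ∀ l : List (Segment V.numBlocks V.diffBlock),
      l.Pairwise (fun σ τ => ∀ a ∈ V.segmentGates τ, ∀ b ∈ V.segmentGates σ, a < b) →
      V.gateProd (Finset.univ.filter fun ν => ∃ σ ∈ l, ν ∈ V.segmentGates σ) θ =
        (l.map (V.segmentUnitary · θ)).prod
  | [], _ => by simp [gateProd_empty]
  | σ :: l, hl => by
    rw [List.pairwise_cons] at hl
    have hunion : (Finset.univ.filter fun ν => ∃ τ ∈ σ :: l, ν ∈ V.segmentGates τ) =
        (Finset.univ.filter fun ν => ∃ τ ∈ l, ν ∈ V.segmentGates τ) ∪ V.segmentGates σ := by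
      ext ν; simp [or_comm]
    rw [hunion, gateProd_union, gateProd_eq_prod_segmentUnitary θ l hl.2, List.map_cons,
      List.prod_cons, segmentUnitary]
    rintro a ha b hb
    obtain ⟨τ, hτ, haτ⟩ := (Finset.mem_filter.1 ha).2
    exact hl.1 τ hτ a haτ b hb

/-- The block that contains a segment. -/
def Segment.blockIndex {K : ℕ} {k₀ : Fin K} : Segment K k₀ → Fin K
  | .block k _ => k
  | .left | .diff | .right => k₀

theorem block_eq_of_mem_segmentGates {σ : Segment V.numBlocks V.diffBlock} {ν : Fin V.numGates}
    (hν : ν ∈ V.segmentGates σ) : V.block ν = σ.blockIndex := by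
  cases σ with
  | block k hk => exact (Finset.mem_filter.1 hν).2
  | left | right => exact (Finset.mem_filter.1 hν).2.1
  | diff => exact congrArg V.block (Finset.mem_singleton.1 hν)

theorem lt_of_mem_segmentGates {σ τ : Segment V.numBlocks V.diffBlock}
    (h : τ.blockIndex < σ.blockIndex) : ∀ a ∈ V.segmentGates τ, ∀ b ∈ V.segmentGates σ, a < b :=
  fun a ha b hb => V.block_mono.reflect_lt <| by
    rwa [V.block_eq_of_mem_segmentGates ha, V.block_eq_of_mem_segmentGates hb]

/-- The blocks after the differential block, latest first. -/
def laterSegments : List (Segment V.numBlocks V.diffBlock) :=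
  ((List.finRange V.numBlocks).reverse.filter (V.diffBlock < ·)).pmap .block fun _ hk =>
    (of_decide_eq_true (List.mem_filter.1 hk).2).ne'

/-- The blocks before the differential block, latest first. -/
def earlierSegments : List (Segment V.numBlocks V.diffBlock) :=
  ((List.finRange V.numBlocks).reverse.filter (· < V.diffBlock)).pmap .block fun _ hk =>
    (of_decide_eq_true (List.mem_filter.1 hk).2).ne

variable {V} in
theorem mem_laterSegments {σ : Segment V.numBlocks V.diffBlock} :
    σ ∈ V.laterSegments ↔ V.diffBlock < σ.blockIndex := by
  cases σ <;> simp [laterSegments, Segment.blockIndex]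

variable {V} in
theorem mem_earlierSegments {σ : Segment V.numBlocks V.diffBlock} :
    σ ∈ V.earlierSegments ↔ σ.blockIndex < V.diffBlock := by
  cases σ <;> simp [earlierSegments, Segment.blockIndex]

/-- The three parts of the differential block, latest first. -/
def diffBlockSegments : List (Segment V.numBlocks V.diffBlock) := [.right, .diff, .left]

/-- All segments of the circuit, latest first. -/
def segments : List (Segment V.numBlocks V.diffBlock) :=
  V.laterSegments ++ (V.diffBlockSegments ++ V.earlierSegments)

theorem pairwise_segments : V.segments.Pairwise fun σ τ =>
    ∀ a ∈ V.segmentGates τ, ∀ b ∈ V.segmentGates σ, a < b := by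
  have hlater : V.laterSegments.Pairwise fun σ τ => τ.blockIndex < σ.blockIndex :=
    (pairwise_filter_reverse_finRange _).pmap _ fun _ _ _ _ h => h
  have hearlier : V.earlierSegments.Pairwise fun σ τ => τ.blockIndex < σ.blockIndex :=
    (pairwise_filter_reverse_finRange _).pmap _ fun _ _ _ _ h => h
  have hmid : ∀ σ ∈ V.diffBlockSegments, σ.blockIndex = V.diffBlock := by
    simp [diffBlockSegments, Segment.blockIndex]
  have hdiffBlock : V.diffBlockSegments.Pairwise fun σ τ =>
      ∀ a ∈ V.segmentGates τ, ∀ b ∈ V.segmentGates σ, a < b := by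
    have hrd : ∀ a ∈ V.segmentGates .diff, ∀ b ∈ V.segmentGates .right, a < b := by
      simp [segmentGates]
    have hrl : ∀ a ∈ V.segmentGates .left, ∀ b ∈ V.segmentGates .right, a < b := by
      grind [segmentGates]
    have hdl : ∀ a ∈ V.segmentGates .left, ∀ b ∈ V.segmentGates .diff, a < b := by
      simp [segmentGates]
    simpa [diffBlockSegments] using ⟨⟨hrd, hrl⟩, hdl⟩
  refine List.pairwise_append.2 ⟨hlater.imp V.lt_of_mem_segmentGates, List.pairwise_append.2
    ⟨hdiffBlock, hearlier.imp V.lt_of_mem_segmentGates, fun σ hσ τ hτ => ?_⟩, fun σ hσ τ hτ => ?_⟩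
  · exact V.lt_of_mem_segmentGates ((mem_earlierSegments.1 hτ).trans_eq (hmid σ hσ).symm)
  · refine V.lt_of_mem_segmentGates (lt_of_le_of_lt ?_ (mem_laterSegments.1 hσ))
    rcases List.mem_append.1 hτ with hτ | hτ
    · exact (hmid τ hτ).le
    · exact (mem_earlierSegments.1 hτ).le

theorem circuit_eq (θ : Fin V.numGates → ℝ) : V.circuit θ =
    (V.laterSegments.map (V.segmentUnitary · θ)).prod * (V.segmentUnitary .right θ *
      (V.segmentUnitary .diff θ * (V.segmentUnitary .left θ *
        (V.earlierSegments.map (V.segmentUnitary · θ)).prod))) := by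
  have huniv : Finset.univ.filter (fun ν => ∃ σ ∈ V.segments, ν ∈ V.segmentGates σ) =
      Finset.univ := by
    refine Finset.filter_true_of_mem fun ν _ => ?_
    simp only [segments, diffBlockSegments, List.mem_append, mem_laterSegments, mem_earlierSegments]
    rcases lt_trichotomy (V.block ν) V.diffBlock with h | h | h
    · exact ⟨.block _ h.ne, by simp [Segment.blockIndex, h], by simp [segmentGates]⟩
    · rcases lt_trichotomy ν V.diffGate with h' | h' | h'
      · exact ⟨.left, by simp, by simp [segmentGates, h, h']⟩
      · exact ⟨.diff, by simp, by simp [segmentGates, h']⟩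
      · exact ⟨.right, by simp, by simp [segmentGates, h, h']⟩
    · exact ⟨.block _ h.ne', by simp [Segment.blockIndex, h], by simp [segmentGates]⟩
  rw [circuit, ← huniv, V.gateProd_eq_prod_segmentUnitary θ _ V.pairwise_segments, segments,
    diffBlockSegments]
  simp only [List.map_append, List.prod_append, List.cons_append, List.nil_append, List.map_cons,
    List.prod_cons]

theorem segmentUnitary_update {σ : Segment V.numBlocks V.diffBlock} (hσ : σ ≠ .diff)
    (θ : Fin V.numGates → ℝ) (t : ℝ) :
    V.segmentUnitary σ (Function.update θ V.diffGate t) = V.segmentUnitary σ θ := by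
  refine V.gateProd_congr fun ν hν => Function.update_of_ne ?_ _ _
  rintro rfl
  cases σ with
  | block k hk => exact hk (Finset.mem_filter.1 hν).2.symm
  | left | right => exact lt_irrefl _ (Finset.mem_filter.1 hν).2.2
  | diff => exact hσ rfl

theorem segmentUnitary_diff {g : PauliString V.numQubits} (hg : V.gen V.diffGate = g.toOp)
    (θ : Fin V.numGates → ℝ) :
    V.segmentUnitary .diff θ = expRotation g.toOp (θ V.diffGate) := by
  rw [← hg]
  exact V.gateProd_singleton _ _

theorem cost_eq (θ : Fin V.numGates → ℝ) :
    V.cost θ = zeroStateExpectation (heisenberg (V.circuit θ) V.hamiltonian) := by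
  rw [cost, initialState, mul_assoc, mul_assoc, ← mul_assoc (V.circuit θ).conjTranspose,
    ← heisenberg_apply, Matrix.trace_single_mul, one_smul]
  rfl

/-- The observable after the segments later than the differential gate, in the Heisenberg
picture. -/
noncomputable def laterObservable (θ : Fin V.numGates → ℝ) : QOp V.numQubits :=
  heisenberg (V.segmentUnitary .right θ)
    (heisenberg (V.laterSegments.map (V.segmentUnitary · θ)).prod V.hamiltonian)

/-- The random unitary of all segments before the differential gate. -/
noncomputable def earlierUnitary (θ : Fin V.numGates → ℝ) : QOp V.numQubits :=
  V.segmentUnitary .left θ * (V.earlierSegments.map (V.segmentUnitary · θ)).prod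

theorem heisenberg_circuit_update {g : PauliString V.numQubits} (hg : V.gen V.diffGate = g.toOp)
    (θ : Fin V.numGates → ℝ) (t : ℝ) :
    heisenberg (V.circuit (Function.update θ V.diffGate t)) V.hamiltonian =
      heisenberg (V.earlierUnitary θ)
        (heisenberg (expRotation g.toOp t) (V.laterObservable θ)) := by
  have hlater : V.laterSegments.map (V.segmentUnitary · (Function.update θ V.diffGate t)) =
      V.laterSegments.map (V.segmentUnitary · θ) :=
    List.map_congr_left fun σ hσ => V.segmentUnitary_update
      (by rintro rfl; exact lt_irrefl _ (mem_laterSegments.1 hσ)) θ t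
  have hearlier : V.earlierSegments.map (V.segmentUnitary · (Function.update θ V.diffGate t)) =
      V.earlierSegments.map (V.segmentUnitary · θ) :=
    List.map_congr_left fun σ hσ => V.segmentUnitary_update
      (by rintro rfl; exact lt_irrefl _ (mem_earlierSegments.1 hσ)) θ t
  rw [circuit_eq, hlater, hearlier, V.segmentUnitary_update (σ := .right) nofun,
    V.segmentUnitary_update (σ := .left) nofun, V.segmentUnitary_diff hg, Function.update_self,
    heisenberg_mul, heisenberg_mul, heisenberg_mul]
  rfl

/-- The derivative of the observable after the differential gate, generated by `g`, with respect to
the parameter of this gate, in the Heisenberg picture. -/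
noncomputable def derivObservable (g : PauliString V.numQubits) (θ : Fin V.numGates → ℝ) :
    QOp V.numQubits :=
  heisenberg (V.segmentUnitary .diff θ) (g.commutator (V.laterObservable θ))

theorem costDeriv_eq {g : PauliString V.numQubits} (hg : V.gen V.diffGate = g.toOp)
    (θ : Fin V.numGates → ℝ) :
    V.costDeriv θ =
      zeroStateExpectation (heisenberg (V.earlierUnitary θ) (V.derivObservable g θ)) := by
  simp only [costDeriv, cost_eq, V.heisenberg_circuit_update hg, derivObservable,
    V.segmentUnitary_diff hg]
  exact (hasDerivAt_linearMap_heisenberg_expRotation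
    (zeroStateExpectation ∘ₗ heisenberg (V.earlierUnitary θ)) g _ _).deriv

end VQE

/-! ### Independent random unitaries -/

section Independence

open PauliString

variable {N : ℕ} {Θ ι : Type*} {U : ι → Θ → QOp N} {S T : Set ι}

namespace IsRandomUnitary

variable {m mΘ : MeasurableSpace Θ} {A B : Θ → QOp N}

theorem mono (hA : IsRandomUnitary m A) (hm : m ≤ mΘ) : IsRandomUnitary mΘ A :=
  ⟨hA.measurable.mono hm le_rfl, hA.mem_unitaryGroup⟩

theorem mul (hA : IsRandomUnitary m A) (hB : IsRandomUnitary m B) :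
    IsRandomUnitary m fun θ => A θ * B θ where
  measurable := by
    have hcont : Continuous fun p : QOp N × QOp N => p.1 * p.2 := by fun_prop
    have hcomp := hcont.measurable.comp (hA.measurable.prodMk hB.measurable)
    exact hcomp
  mem_unitaryGroup θ := mul_mem (hA.mem_unitaryGroup θ) (hB.mem_unitaryGroup θ)

theorem list_prod {l : List ι} (hU : ∀ i ∈ l, IsRandomUnitary m (U i)) :
    IsRandomUnitary m fun θ => (l.map (U · θ)).prod := by
  induction l with
  | nil => exact ⟨measurable_const, fun _ => one_mem _⟩
  | cons i l ih =>
    simp only [List.map_cons, List.prod_cons]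
    exact (hU i List.mem_cons_self).mul (ih fun j hj => hU j (List.mem_cons_of_mem i hj))

end IsRandomUnitary

/-- The σ-algebra generated by the random operators `U i` with `i ∈ S`. -/
noncomputable abbrev generatedBy (U : ι → Θ → QOp N) (S : Set ι) : MeasurableSpace Θ :=
  ⨆ i ∈ S, MeasurableSpace.comap (U i) inferInstance

theorem generatedBy_mono (U : ι → Θ → QOp N) (h : S ⊆ T) : generatedBy U S ≤ generatedBy U T :=
  biSup_mono h

theorem measurable_generatedBy {i : ι} (hi : i ∈ S) : Measurable[generatedBy U S] (U i) :=
  measurable_iff_comap_le.2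
    (le_biSup (fun i => MeasurableSpace.comap (U i) inferInstance) hi)

variable {mΘ : MeasurableSpace Θ} {μ : Measure Θ} {A B : Θ → QOp N}

theorem generatedBy_le (hU : ∀ i, IsRandomUnitary mΘ (U i)) (S : Set ι) : generatedBy U S ≤ mΘ :=
  iSup₂_le fun i _ => (hU i).measurable.comap_le

theorem IsRandomUnitary.generatedBy {i : ι} (hU : IsRandomUnitary mΘ (U i)) (hi : i ∈ S) :
    IsRandomUnitary (generatedBy U S) (U i) :=
  ⟨measurable_generatedBy hi, hU.mem_unitaryGroup⟩

theorem indepFun_of_disjoint (hU : ∀ i, IsRandomUnitary mΘ (U i)) (hind : iIndepFun U μ)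
    (hST : Disjoint S T) (hA : Measurable[generatedBy U S] A)
    (hB : Measurable[generatedBy U T] B) : IndepFun A B μ := by
  have hgen := indep_iSup_of_disjoint (fun i => (hU i).measurable.comap_le) hind hST
  rw [IndepFun_iff_Indep]
  exact indep_of_indep_of_le_left (indep_of_indep_of_le_right hgen hB.comap_le) hA.comap_le

theorem MomentBound.heisenberg_list_prod [IsFiniteMeasure μ] {F : Finset (PauliString N)}
    {c : Set (Fin N)} {w : PauliString N → ℝ} {s : ι → Finset (Fin N)} {l : List ι}
    (hU : ∀ i, IsRandomUnitary mΘ (U i)) (hind : iIndepFun U μ)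
    (hA : IsRandomObservable (generatedBy U S) A) (hM : MomentBound F c w (secondMoment μ A))
    (hl : l.Nodup) (hlS : ∀ i ∈ l, i ∉ S) (hdesign : ∀ i ∈ l, IsLocalDesign 2 μ (s i) (U i)) :
    MomentBound F (c ∪ {q | ∃ i ∈ l, q ∈ s i})
      (fun h => w h * (l.map fun i => blockFactor (s i) h).prod)
      (secondMoment μ fun θ => heisenberg (l.map (U · θ)).prod (A θ)) := by
  induction l using List.reverseRecOn with
  | nil => simpa [heisenberg_apply] using hM
  | append_singleton l i ih =>
    simp only [List.forall_mem_append, List.forall_mem_singleton] at hlS hdesign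
    obtain ⟨hl, hil⟩ : l.Nodup ∧ i ∉ l := by
      simpa [List.nodup_append, ← List.forall_mem_ne'] using hl
    have hobs : IsRandomObservable (generatedBy U (S ∪ {j | j ∈ l}))
        fun θ => heisenberg (l.map (U · θ)).prod (A θ) :=
      (hA.mono (generatedBy_mono U Set.subset_union_left)).heisenberg
        (.list_prod fun j hj => (hU j).generatedBy (.inr hj))
    have hindi : IndepFun (fun θ => heisenberg (l.map (U · θ)).prod (A θ)) (U i) μ :=
      indepFun_of_disjoint hU hind
        (Set.disjoint_singleton_right.2 fun hi => hi.elim hlS.2 hil) hobs.measurable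
        (measurable_generatedBy (Set.mem_singleton i))
    have hstep := (ih hl hlS.1 hdesign.1).twirlMoment (s i)
    rw [← hdesign.2.secondMoment_heisenberg (hobs.mono (generatedBy_le hU _)) hindi] at hstep
    convert hstep using 1
    · ext q
      simp [or_and_right, exists_or, or_assoc]
    · funext h
      simp [mul_assoc]
    · simp [heisenberg_mul]

end Independence

/-! ### The differential block -/

section DifferentialBlock

open PauliString

variable {N : ℕ} {Θ : Type*} {mΘ : MeasurableSpace Θ} {μ : Measure Θ} [IsFiniteMeasure μ]
  {s : Finset (Fin N)} {A L R : Θ → QOp N}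

theorem IsRandomObservable.integral_coeff_commutator_heisenberg_eq_zero
    (hA : IsRandomObservable mΘ A) (hR : IsLocalDesign 2 μ s R) (hAR : IndepFun A R μ)
    {g : PauliString N} (hg : g.support ⊆ s) (Q : PauliString N) :
    ∫ θ, coeff Q (g.commutator (_root_.heisenberg (R θ) (A θ))) ∂μ = 0 := by
  rw [integral_coeff_commutator]
  rcases Int.units_eq_one_or (sign Q g) with hcomm | hanti
  · rw [structConst, if_pos hcomm, zero_mul]
  · have hQg : ¬ Disjoint (Q * g).support s :=
      not_disjoint_support_of_sign hg (by rw [sign_mul_left, sign_self, mul_one, hanti])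
    rw [hA.integral_coeff_heisenberg hR.isRandomUnitary hAR]
    simp only [hR.integral_transfer_eq_zero _ hQg, mul_zero, Finset.sum_const_zero]

theorem IsRandomObservable.integral_coeff_heisenberg_eq_zero {B : Θ → QOp N}
    (hA : IsRandomObservable mΘ A) (hB : IsRandomUnitary mΘ B) (hAB : IndepFun A B μ)
    (hmean : ∀ P, ∫ θ, coeff P (A θ) ∂μ = 0) (Q : PauliString N) :
    ∫ θ, coeff Q (_root_.heisenberg (B θ) (A θ)) ∂μ = 0 := by
  simp only [hA.integral_coeff_heisenberg hB hAB, hmean, zero_mul, Finset.sum_const_zero]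

theorem IsRandomObservable.secondMoment_differentialBlock (hA : IsRandomObservable mΘ A)
    (hR : IsLocalDesign 2 μ s R) (hL : IsLocalDesign 2 μ s L) (hAR : IndepFun A R μ)
    {W : Θ → Matrix.unitaryGroup (s → Fin 2) ℂ} (hW : Measurable W) (g : PauliString N)
    (hAL : IndepFun (fun θ => _root_.heisenberg (localUnitary s (W θ))
      (g.commutator (_root_.heisenberg (R θ) (A θ)))) L μ) :
    secondMoment μ (fun θ => _root_.heisenberg (L θ) (_root_.heisenberg (localUnitary s (W θ))
        (g.commutator (_root_.heisenberg (R θ) (A θ))))) =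
      twirlMoment s (commutatorMoment g (twirlMoment s (secondMoment μ A))) := by
  have hcomm := (hA.heisenberg hR.isRandomUnitary).commutator g
  rw [hL.secondMoment_heisenberg (hcomm.heisenberg (.localUnitary hW)) hAL,
    hcomm.twirlMoment_secondMoment_heisenberg hW, secondMoment_commutator,
    hR.secondMoment_heisenberg hA hAR]

end DifferentialBlock

/-! ### The variance of the expected value in the initial state -/

section Variance

open PauliString

variable {N : ℕ}

theorem zeroStateExpectation_eq_sum {A : QOp N} (hA : A.IsHermitian) :
    zeroStateExpectation A = ∑ Q, coeff Q A * zeroStateExpectation (toOp Q) := by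
  conv_lhs => rw [← sum_coeff_smul_toOp hA]
  simp only [map_sum, map_smul, smul_eq_mul]

theorem zeroStateExpectation_toOp (Q : PauliString N) :
    zeroStateExpectation Q.toOp = if ∀ i, Q i = 1 ∨ Q i = .Z then 1 else 0 := by
  change (Q.toOp 0 0).re = _
  rw [toOp_zero_zero]
  split_ifs <;> simp

theorem zeroStateExpectation_toOp_collapseZ_univ (h : PauliString N) :
    zeroStateExpectation (collapseZ Set.univ h).toOp = 1 := by
  rw [zeroStateExpectation_toOp, if_pos fun i => ?_]
  by_cases hi : h i = 1 <;> simp [collapseZ, hi]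

theorem zeroStateExpectation_toOp_sq (Q : PauliString N) :
    zeroStateExpectation Q.toOp ^ 2 = zeroStateExpectation Q.toOp := by
  rw [zeroStateExpectation_toOp]
  split_ifs <;> norm_num

variable {Θ : Type*} {mΘ : MeasurableSpace Θ} {μ : Measure Θ} [IsFiniteMeasure μ] {A : Θ → QOp N}

theorem IsRandomObservable.integral_zeroStateExpectation_sq (hA : IsRandomObservable mΘ A)
    (hdiag : ∀ Q Q', secondMoment μ A Q Q' ≠ 0 → Q = Q') :
    ∫ θ, zeroStateExpectation (A θ) ^ 2 ∂μ =
      ∑ Q, secondMoment μ A Q Q * zeroStateExpectation (toOp Q) := by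
  have hint (Q Q' : PauliString N) := (hA.integrable_coeff_mul_coeff μ Q Q').mul_const
    (zeroStateExpectation Q.toOp * zeroStateExpectation Q'.toOp)
  have hsq (θ : Θ) : zeroStateExpectation (A θ) ^ 2 = ∑ Q, ∑ Q', coeff Q (A θ) * coeff Q' (A θ) *
      (zeroStateExpectation (toOp Q) * zeroStateExpectation (toOp Q')) := by
    simp only [zeroStateExpectation_eq_sum (hA.isHermitian θ), sq, Finset.sum_mul_sum,
      mul_mul_mul_comm]
  simp only [hsq, integral_sum_sum hint, integral_mul_const]
  refine Finset.sum_congr rfl fun Q _ => ?_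
  rw [Fintype.sum_eq_single Q fun Q' hQ' => ?_, ← sq, zeroStateExpectation_toOp_sq, secondMoment]
  rw [← secondMoment, not_imp_comm.1 (hdiag Q Q') hQ'.symm, zero_mul]

theorem MomentBound.sum_le_variance_zeroStateExpectation {F : Finset (PauliString N)}
    {w : PauliString N → ℝ} (hA : IsRandomObservable mΘ A)
    (hmean : ∀ Q, ∫ θ, coeff Q (A θ) ∂μ = 0)
    (hM : MomentBound F Set.univ w (secondMoment μ A)) :
    ∑ h ∈ F, w h ≤ variance (fun θ => zeroStateExpectation (A θ)) μ := by
  have hint (Q : PauliString N) :=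
    (hA.integrable_coeff μ Q).mul_const (zeroStateExpectation Q.toOp)
  have hmeas : AEMeasurable (fun θ => zeroStateExpectation (A θ)) μ := by
    simp only [zeroStateExpectation_eq_sum (hA.isHermitian _)]
    exact (integrable_finsetSum _ fun Q _ => hint Q).aemeasurable
  have hzero : ∫ θ, zeroStateExpectation (A θ) ∂μ = 0 := by
    simp only [zeroStateExpectation_eq_sum (hA.isHermitian _),
      integral_finsetSum _ fun Q _ => hint Q, integral_mul_const, hmean, zero_mul,
      Finset.sum_const_zero]
  have hlower := hM.sum_le (fun Q => zeroStateExpectation Q.toOp) fun Q => by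
    rw [← zeroStateExpectation_toOp_sq]
    exact sq_nonneg _
  simp only [zeroStateExpectation_toOp_collapseZ_univ, mul_one] at hlower
  rw [variance_of_integral_eq_zero hmeas hzero]
  exact hlower.trans_eq (hA.integral_zeroStateExpectation_sq fun Q Q' h =>
    (Set.eqOn_univ Q Q').1 (hM.eqOn Q Q' h)).symm

end Variance

/-! ### The variance of the cost derivative -/

section Const

open PauliString

variable {N : ℕ} {Θ : Type*} {mΘ : MeasurableSpace Θ} {μ : Measure Θ} [IsProbabilityMeasure μ]

theorem MomentBound.const (F : Finset (PauliString N)) {c : Set (Fin N)} {A : QOp N}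
    (hc : ∀ h, coeff h A ≠ 0 → ∀ q ∈ c, h q = 1) :
    MomentBound F c (fun h => coeff h A ^ 2) (secondMoment μ fun _ => A) := by
  have hmoment (Q Q' : PauliString N) :
      secondMoment μ (fun _ => A) Q Q' = coeff Q A * coeff Q' A := by
    simp [secondMoment]
  refine ⟨fun Q Q' h q hq => ?_, fun h => sq_nonneg _, fun f hf => ?_⟩
  · rw [hmoment] at h
    rw [hc Q (left_ne_zero_of_mul h) q hq, hc Q' (right_ne_zero_of_mul h) q hq]
  · have hcollapse (h : PauliString N) :
        coeff h A ^ 2 * f (collapseZ c h) = coeff h A * coeff h A * f h := by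
      by_cases hh : coeff h A = 0
      · simp [hh]
      · have hfix : collapseZ c h = h := funext fun q => if_neg fun hq => hq.2 (hc h hh q hq.1)
        rw [hfix, sq]
    simp only [hcollapse, hmoment]
    exact Finset.sum_le_sum_of_subset_of_nonneg (Finset.subset_univ F) fun Q _ _ =>
      mul_nonneg (mul_self_nonneg _) (hf Q)

end Const

namespace VQE

open PauliString

variable {V : VQE}

instance : IsProbabilityMeasure V.law := V.law_isProbability

theorem coeff_hamiltonian (Q : PauliString V.numQubits) :
    PauliString.coeff Q V.hamiltonian = V.coeff Q := by
  simp [hamiltonian, map_sum, Complex.coe_smul, coeff_toOp]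

theorem hamiltonian_isHermitian (V : VQE) : V.hamiltonian.IsHermitian := by
  refine isSelfAdjoint_sum _ fun h _ => ?_
  rw [Complex.coe_smul]
  exact (IsSelfAdjoint.all (V.coeff h)).smul h.toOp_isHermitian

theorem support_subset_blockSupport {g : PauliString V.numQubits}
    (hg : V.gen V.diffGate = g.toOp) : g.support ⊆ V.blockSupport V.diffBlock := by
  refine (support_subset_opSupport g).trans ?_
  rw [← hg]
  exact Finset.subset_biUnion_of_mem (fun ν => opSupport (V.gen ν))
    (Finset.mem_filter.2 ⟨Finset.mem_univ _, rfl⟩)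

theorem exists_localUnitary_eq_segmentUnitary_diff {g : PauliString V.numQubits}
    (hg : V.gen V.diffGate = g.toOp) :
    ∃ W : (Fin V.numGates → ℝ) →
        Matrix.unitaryGroup (V.blockSupport V.diffBlock → Fin 2) ℂ, Measurable W ∧
      V.segmentUnitary .diff = fun θ => ↑(localUnitary (V.blockSupport V.diffBlock) (W θ)) := by
  obtain ⟨W, hW, hWeq⟩ := exists_localUnitary_eq_expRotation g.toOp_isHermitian
    (toOp_mem_range_embedHom (support_subset_blockSupport hg))
  refine ⟨fun θ => W (θ V.diffGate), hW.measurable.comp (measurable_pi_apply _), funext fun θ => ?_⟩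
  rw [V.segmentUnitary_diff hg, hWeq]

theorem map_blockIndex_laterSegments (V : VQE) : V.laterSegments.map Segment.blockIndex =
    (List.finRange V.numBlocks).reverse.filter (V.diffBlock < ·) := by
  simp [laterSegments, List.map_pmap, Segment.blockIndex]

theorem map_blockIndex_earlierSegments (V : VQE) : V.earlierSegments.map Segment.blockIndex =
    (List.finRange V.numBlocks).reverse.filter (· < V.diffBlock) := by
  simp [earlierSegments, List.map_pmap, Segment.blockIndex]

theorem nodup_laterSegments (V : VQE) : V.laterSegments.Nodup :=
  .of_map Segment.blockIndex <| V.map_blockIndex_laterSegments ▸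
    (pairwise_filter_reverse_finRange _).imp ne_of_gt

theorem nodup_earlierSegments (V : VQE) : V.earlierSegments.Nodup :=
  .of_map Segment.blockIndex <| V.map_blockIndex_earlierSegments ▸
    (pairwise_filter_reverse_finRange _).imp ne_of_gt

theorem prod_map_filter_reverse_finRange {n : ℕ} (p : Fin n → Prop) [DecidablePred p]
    (f : Fin n → ℝ) : (((List.finRange n).reverse.filter p).map f).prod = ∏ k with p k, f k := by
  rw [← List.prod_toFinset f ((pairwise_filter_reverse_finRange _).imp ne_of_gt)]
  congr 1
  ext k
  simp

theorem prod_eq_prod_segments (f : Fin V.numBlocks → ℝ) :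
    ∏ k, f k = (V.laterSegments.map fun σ => f σ.blockIndex).prod * f V.diffBlock *
      (V.earlierSegments.map fun σ => f σ.blockIndex).prod := by
  have hlater : (V.laterSegments.map fun σ => f σ.blockIndex).prod =
      ∏ k with V.diffBlock < k, f k := by
    rw [← prod_map_filter_reverse_finRange, ← map_blockIndex_laterSegments, List.map_map]
    rfl
  have hearlier : (V.earlierSegments.map fun σ => f σ.blockIndex).prod =
      ∏ k with k < V.diffBlock, f k := by
    rw [← prod_map_filter_reverse_finRange, ← map_blockIndex_earlierSegments, List.map_map]
    rfl
  have hsplit : (Finset.univ.filter fun k => ¬ V.diffBlock < k) =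
      insert V.diffBlock (Finset.univ.filter (· < V.diffBlock)) := by
    ext k
    simp [le_iff_eq_or_lt]
  rw [hlater, hearlier, ← Finset.prod_filter_mul_prod_filter_not _ (V.diffBlock < ·), hsplit,
    Finset.prod_insert (by simp), mul_assoc]

theorem blockSupport_union_eq_univ (V : VQE) : {q | ∀ k, q ∉ V.blockSupport k} ∪
    {q | ∃ σ ∈ V.laterSegments, q ∈ V.blockSupport σ.blockIndex} ∪
    V.blockSupport V.diffBlock ∪
    {q | ∃ σ ∈ V.earlierSegments, q ∈ V.blockSupport σ.blockIndex} = Set.univ := by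
  refine Set.eq_univ_of_forall fun q => ?_
  by_cases hq : ∃ k, q ∈ V.blockSupport k
  · obtain ⟨k, hk⟩ := hq
    rcases lt_trichotomy k V.diffBlock with h | rfl | h
    · exact .inr ⟨.block k h.ne, mem_earlierSegments.2 h, hk⟩
    · exact .inl (.inr hk)
    · exact .inl (.inl (.inr ⟨.block k h.ne', mem_laterSegments.2 h, hk⟩))
  · exact .inl (.inl (.inl (not_exists.1 hq)))

namespace Assumptions

theorem isLocalDesign (hV : V.Assumptions) {σ : Segment V.numBlocks V.diffBlock}
    (hσ : σ ≠ .diff) :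
    IsLocalDesign 2 V.law (V.blockSupport σ.blockIndex) (V.segmentUnitary σ) := by
  cases σ with
  | block k hk => exact hV.block_design k hk
  | left => exact hV.left_design
  | diff => exact absurd rfl hσ
  | right => exact hV.right_design

theorem isRandomUnitary (hV : V.Assumptions) (σ : Segment V.numBlocks V.diffBlock) :
    IsRandomUnitary inferInstance (V.segmentUnitary σ) := by
  by_cases hσ : σ = .diff
  · obtain ⟨g, -, hg⟩ := hV.gen_pauli
    obtain ⟨W, hW, hWeq⟩ := exists_localUnitary_eq_segmentUnitary_diff hg
    rw [hσ, hWeq]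
    exact .localUnitary hW
  · exact (hV.isLocalDesign hσ).isRandomUnitary

theorem isRandomObservable_heisenberg_laterSegments (hV : V.Assumptions) :
    IsRandomObservable (generatedBy V.segmentUnitary {σ | V.diffBlock < σ.blockIndex})
      fun θ => heisenberg (V.laterSegments.map (V.segmentUnitary · θ)).prod V.hamiltonian :=
  (IsRandomObservable.const _ V.hamiltonian_isHermitian).heisenberg <| .list_prod fun σ hσ =>
    (hV.isRandomUnitary σ).generatedBy (mem_laterSegments.1 hσ)

theorem isRandomObservable_commutator_laterObservable (hV : V.Assumptions)
    (g : PauliString V.numQubits) :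
    IsRandomObservable
      (generatedBy V.segmentUnitary (insert .right {σ | V.diffBlock < σ.blockIndex}))
      fun θ => g.commutator (V.laterObservable θ) :=
  ((hV.isRandomObservable_heisenberg_laterSegments.mono
    (generatedBy_mono _ (Set.subset_insert _ _))).heisenberg
      ((hV.isRandomUnitary .right).generatedBy (Set.mem_insert _ _))).commutator g

theorem isRandomObservable_derivObservable (hV : V.Assumptions) (g : PauliString V.numQubits) :
    IsRandomObservable
      (generatedBy V.segmentUnitary (insert .diff (insert .right {σ | V.diffBlock < σ.blockIndex})))
      (V.derivObservable g) :=
  ((hV.isRandomObservable_commutator_laterObservable g).mono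
    (generatedBy_mono _ (Set.subset_insert _ _))).heisenberg
      ((hV.isRandomUnitary .diff).generatedBy (Set.mem_insert _ _))

theorem isRandomUnitary_earlierUnitary (hV : V.Assumptions) :
    IsRandomUnitary
      (generatedBy V.segmentUnitary (insert .left {σ | σ.blockIndex < V.diffBlock}))
      V.earlierUnitary :=
  ((hV.isRandomUnitary .left).generatedBy (Set.mem_insert _ _)).mul <| .list_prod fun σ hσ =>
    (hV.isRandomUnitary σ).generatedBy (.inr (mem_earlierSegments.1 hσ))

theorem indepFun (hV : V.Assumptions) {S T : Set (Segment V.numBlocks V.diffBlock)}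
    (hST : Disjoint S T) {A B : (Fin V.numGates → ℝ) → QOp V.numQubits}
    (hA : Measurable[generatedBy V.segmentUnitary S] A)
    (hB : Measurable[generatedBy V.segmentUnitary T] B) : IndepFun A B V.law :=
  indepFun_of_disjoint hV.isRandomUnitary hV.indep hST hA hB

theorem indepFun_laterSegments_right (hV : V.Assumptions) :
    IndepFun (fun θ => heisenberg (V.laterSegments.map (V.segmentUnitary · θ)).prod V.hamiltonian)
      (V.segmentUnitary .right) V.law :=
  hV.indepFun (Set.disjoint_singleton_right.2 (lt_irrefl V.diffBlock))
    hV.isRandomObservable_heisenberg_laterSegments.measurable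
    (measurable_generatedBy (Set.mem_singleton _))

theorem momentBound_laterSegments (hV : V.Assumptions) :
    MomentBound V.relevantTerms
      ({q | ∀ k, q ∉ V.blockSupport k} ∪
        {q | ∃ σ ∈ V.laterSegments, q ∈ V.blockSupport σ.blockIndex})
      (fun h => V.coeff h ^ 2 *
        (V.laterSegments.map fun σ => blockFactor (V.blockSupport σ.blockIndex) h).prod)
      (secondMoment V.law fun θ =>
        heisenberg (V.laterSegments.map (V.segmentUnitary · θ)).prod V.hamiltonian) := by
  have hconst : MomentBound V.relevantTerms {q | ∀ k, q ∉ V.blockSupport k}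
      (fun h => V.coeff h ^ 2) (secondMoment V.law fun _ => V.hamiltonian) := by
    simp only [← coeff_hamiltonian]
    refine .const _ fun h hh q hq => by_contra fun hhq => ?_
    rw [coeff_hamiltonian] at hh
    obtain ⟨k, hk⟩ := hV.covers h (Finset.mem_filter.2 ⟨Finset.mem_univ h, hh⟩) q
      (mem_support.2 hhq)
    exact hq k hk
  exact hconst.heisenberg_list_prod hV.isRandomUnitary hV.indep
    (.const (generatedBy V.segmentUnitary ∅) V.hamiltonian_isHermitian)
    V.nodup_laterSegments (fun σ _ => Set.notMem_empty σ) fun σ hσ =>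
      hV.isLocalDesign (by rintro rfl; exact lt_irrefl _ (mem_laterSegments.1 hσ))

theorem isRandomObservable_heisenberg_earlierUnitary (hV : V.Assumptions)
    (g : PauliString V.numQubits) :
    IsRandomObservable inferInstance
      fun θ => heisenberg (V.earlierUnitary θ) (V.derivObservable g θ) :=
  ((hV.isRandomObservable_derivObservable g).mono (generatedBy_le hV.isRandomUnitary _)).heisenberg
    (hV.isRandomUnitary_earlierUnitary.mono (generatedBy_le hV.isRandomUnitary _))

theorem integral_coeff_derivObservable (hV : V.Assumptions) {g : PauliString V.numQubits}
    (hg : V.gen V.diffGate = g.toOp) (Q : PauliString V.numQubits) :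
    ∫ θ, PauliString.coeff Q (V.derivObservable g θ) ∂V.law = 0 := by
  have hle := generatedBy_le hV.isRandomUnitary
  have hcomm := hV.isRandomObservable_commutator_laterObservable g
  refine (hcomm.mono (hle _)).integral_coeff_heisenberg_eq_zero (hV.isRandomUnitary .diff)
    (hV.indepFun (Set.disjoint_singleton_right.2 (by simp [Segment.blockIndex])) hcomm.measurable
      (measurable_generatedBy (Set.mem_singleton _))) (fun P => ?_) Q
  exact (hV.isRandomObservable_heisenberg_laterSegments.mono
    (hle _)).integral_coeff_commutator_heisenberg_eq_zero hV.right_design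
      hV.indepFun_laterSegments_right (support_subset_blockSupport hg) P

theorem integral_coeff_heisenberg_earlierUnitary (hV : V.Assumptions)
    {g : PauliString V.numQubits} (hg : V.gen V.diffGate = g.toOp) (Q : PauliString V.numQubits) :
    ∫ θ, PauliString.coeff Q (heisenberg (V.earlierUnitary θ) (V.derivObservable g θ)) ∂V.law =
      0 := by
  have hle := generatedBy_le hV.isRandomUnitary
  have hobs := hV.isRandomObservable_derivObservable g
  have hdisj : Disjoint (insert .diff (insert .right {σ | V.diffBlock < σ.blockIndex}))
      (insert .left {σ : Segment V.numBlocks V.diffBlock | σ.blockIndex < V.diffBlock}) := by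
    simpa [Segment.blockIndex, Set.disjoint_left] using fun σ h =>
      ⟨by rintro rfl; exact lt_irrefl _ h, h.le⟩
  exact (hobs.mono (hle _)).integral_coeff_heisenberg_eq_zero
    (hV.isRandomUnitary_earlierUnitary.mono (hle _))
    (hV.indepFun hdisj hobs.measurable hV.isRandomUnitary_earlierUnitary.measurable)
    (hV.integral_coeff_derivObservable hg) Q

theorem momentBound_diffBlock (hV : V.Assumptions) {g : PauliString V.numQubits}
    (hg : V.gen V.diffGate = g.toOp) (hgne : g.support.Nonempty) :
    MomentBound V.relevantTerms
      ({q | ∀ k, q ∉ V.blockSupport k} ∪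
        {q | ∃ σ ∈ V.laterSegments, q ∈ V.blockSupport σ.blockIndex} ∪
        V.blockSupport V.diffBlock)
      (fun h => V.coeff h ^ 2 *
        (V.laterSegments.map fun σ => blockFactor (V.blockSupport σ.blockIndex) h).prod *
        (2 * (4 ^ (V.blockSupport V.diffBlock).card)⁻¹))
      (secondMoment V.law fun θ =>
        heisenberg (V.segmentUnitary .left θ) (V.derivObservable g θ)) := by
  obtain ⟨W, hW, hWeq⟩ := exists_localUnitary_eq_segmentUnitary_diff hg
  have hobs := hV.isRandomObservable_derivObservable g
  have hleft : IndepFun (V.derivObservable g) (V.segmentUnitary .left) V.law :=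
    hV.indepFun (Set.disjoint_singleton_right.2 (by simp [Segment.blockIndex])) hobs.measurable
      (measurable_generatedBy (Set.mem_singleton _))
  have hderiv : V.derivObservable g = fun θ =>
      heisenberg (localUnitary (V.blockSupport V.diffBlock) (W θ))
        (g.commutator (V.laterObservable θ)) := by
    unfold derivObservable
    rw [hWeq]
  rw [hderiv] at hleft ⊢
  have hmoment := (hV.isRandomObservable_heisenberg_laterSegments.mono
    (generatedBy_le hV.isRandomUnitary _)).secondMoment_differentialBlock hV.right_design
      hV.left_design hV.indepFun_laterSegments_right hW g hleft
  simp only [laterObservable]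
  rw [hmoment]
  refine hV.momentBound_laterSegments.twirlMoment_commutatorMoment (support_subset_blockSupport hg)
    hgne fun h hh => ?_
  rw [Finset.not_disjoint_iff_nonempty_inter]
  exact (Finset.mem_filter.1 hh).2

theorem momentBound_heisenberg_earlierUnitary (hV : V.Assumptions) {g : PauliString V.numQubits}
    (hg : V.gen V.diffGate = g.toOp) (hgne : g.support.Nonempty) :
    MomentBound V.relevantTerms Set.univ
      (fun h => V.coeff h ^ 2 *
        (V.laterSegments.map fun σ => blockFactor (V.blockSupport σ.blockIndex) h).prod *
        (2 * (4 ^ (V.blockSupport V.diffBlock).card)⁻¹) *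
        (V.earlierSegments.map fun σ => blockFactor (V.blockSupport σ.blockIndex) h).prod)
      (secondMoment V.law fun θ => heisenberg (V.earlierUnitary θ) (V.derivObservable g θ)) := by
  have hobs := ((hV.isRandomObservable_derivObservable g).mono
    (generatedBy_mono _ (Set.subset_insert .left _))).heisenberg
      ((hV.isRandomUnitary .left).generatedBy (Set.mem_insert _ _))
  have hnotMem : ∀ σ ∈ V.earlierSegments,
      σ ∉ insert .left (insert .diff (insert .right {σ | V.diffBlock < σ.blockIndex})) := by
    intro σ hσ
    rw [mem_earlierSegments] at hσ
    rintro (rfl | rfl | rfl | h)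
    exacts [lt_irrefl _ hσ, lt_irrefl _ hσ, lt_irrefl _ hσ, lt_asymm hσ h]
  have hdesign : ∀ σ ∈ V.earlierSegments,
      IsLocalDesign 2 V.law (V.blockSupport σ.blockIndex) (V.segmentUnitary σ) := fun σ hσ =>
    hV.isLocalDesign (by rintro rfl; exact lt_irrefl _ (mem_earlierSegments.1 hσ))
  have hbound := (hV.momentBound_diffBlock hg hgne).heisenberg_list_prod hV.isRandomUnitary
    hV.indep hobs V.nodup_earlierSegments hnotMem hdesign
  rw [V.blockSupport_union_eq_univ] at hbound
  simp only [earlierUnitary, heisenberg_mul]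
  exact hbound

theorem sum_prod_blockFactor_le_gradVariance (hV : V.Assumptions) :
    ∑ h ∈ V.relevantTerms, 2 * V.coeff h ^ 2 * ∏ k, blockFactor (V.blockSupport k) h ≤
      V.gradVariance := by
  obtain ⟨g, hgne, hg⟩ := hV.gen_pauli
  have hvar := MomentBound.sum_le_variance_zeroStateExpectation
    (hV.isRandomObservable_heisenberg_earlierUnitary g)
    (hV.integral_coeff_heisenberg_earlierUnitary hg)
    (hV.momentBound_heisenberg_earlierUnitary hg hgne)
  simp only [← V.costDeriv_eq hg] at hvar
  refine le_of_eq_of_le (Finset.sum_congr rfl fun h hh => ?_) hvar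
  have hdiff : blockFactor (V.blockSupport V.diffBlock) h =
      (4 ^ (V.blockSupport V.diffBlock).card)⁻¹ :=
    if_neg (Finset.not_disjoint_iff_nonempty_inter.2 (Finset.mem_filter.1 hh).2)
  rw [prod_eq_prod_segments, hdiff]
  ring

end Assumptions

theorem card_filter_not_disjoint_blockSupport_le {h : PauliString V.numQubits} (hh : h ∈ V.terms) :
    (Finset.univ.filter fun k => ¬ Disjoint h.support (V.blockSupport k)).card ≤
      V.interactionRange * V.maxLocalDepth := by
  have hsub : (Finset.univ.filter fun k => ¬ Disjoint h.support (V.blockSupport k)) ⊆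
      h.support.biUnion fun q => Finset.univ.filter fun k => q ∈ V.blockSupport k := by
    intro k hk
    obtain ⟨q, hq, hqk⟩ := Finset.not_disjoint_iff.1 (Finset.mem_filter.1 hk).2
    exact Finset.mem_biUnion.2 ⟨q, hq, Finset.mem_filter.2 ⟨Finset.mem_univ k, hqk⟩⟩
  calc (Finset.univ.filter fun k => ¬ Disjoint h.support (V.blockSupport k)).card
      ≤ ∑ q ∈ h.support, V.localDepth q :=
        (Finset.card_le_card hsub).trans Finset.card_biUnion_le
    _ ≤ h.support.card * V.maxLocalDepth :=
        Finset.sum_le_card_nsmul _ _ _ fun q _ => Finset.le_sup (Finset.mem_univ q)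
    _ ≤ V.interactionRange * V.maxLocalDepth :=
        Nat.mul_le_mul_right _ (Finset.le_sup (f := fun h => h.support.card) hh)

theorem inv_pow_le_prod_blockFactor {h : PauliString V.numQubits} (hh : h ∈ V.terms) :
    ((4 : ℝ) ^ (V.interactionRange * V.maxLocalDepth * V.maxBlockSize))⁻¹ ≤
      ∏ k, blockFactor (V.blockSupport k) h := by
  have hfactor (k : Fin V.numBlocks) : ((4 : ℝ) ^ V.maxBlockSize)⁻¹ ≤
      ((4 : ℝ) ^ (V.blockSupport k).card)⁻¹ :=
    inv_anti₀ (by positivity) (pow_le_pow_right₀ (by norm_num)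
      (Finset.le_sup (f := fun k => (V.blockSupport k).card) (Finset.mem_univ k)))
  calc ((4 : ℝ) ^ (V.interactionRange * V.maxLocalDepth * V.maxBlockSize))⁻¹
      = ((4 : ℝ) ^ V.maxBlockSize)⁻¹ ^ (V.interactionRange * V.maxLocalDepth) := by
        rw [inv_pow, ← pow_mul, mul_comm]
    _ ≤ ((4 : ℝ) ^ V.maxBlockSize)⁻¹ ^
          (Finset.univ.filter fun k => ¬ Disjoint h.support (V.blockSupport k)).card :=
        pow_le_pow_of_le_one (by positivity) (inv_le_one_of_one_le₀ (one_le_pow₀ (by norm_num)))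
          (card_filter_not_disjoint_blockSupport_le hh)
    _ ≤ ∏ k with ¬ Disjoint h.support (V.blockSupport k), ((4 : ℝ) ^ (V.blockSupport k).card)⁻¹ :=
        (Finset.prod_const _).symm.trans_le
          (Finset.prod_le_prod (fun _ _ => by positivity) fun k _ => hfactor k)
    _ = ∏ k, blockFactor (V.blockSupport k) h := by
        rw [Finset.prod_filter]
        simp only [blockFactor, ite_not]

theorem Assumptions.le_gradVariance (hV : V.Assumptions) :
    (4 : ℝ) ^ (-((V.interactionRange * V.maxLocalDepth * V.maxBlockSize : ℕ) : ℤ)) *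
      ∑ h ∈ V.relevantTerms, 2 * V.coeff h ^ 2 ≤ V.gradVariance := by
  refine le_trans ?_ hV.sum_prod_blockFactor_le_gradVariance
  rw [zpow_neg, zpow_natCast, Finset.mul_sum]
  refine Finset.sum_le_sum fun h hh => ?_
  rw [mul_comm]
  exact mul_le_mul_of_nonneg_left (inv_pow_le_prod_blockFactor (Finset.mem_filter.1 hh).1)
    (by positivity)

end VQE

theorem not_hasBarrenPlateau_of_le {V : ℕ → VQE} {ε : ℝ} (hε : 0 < ε)
    (h : ∀ n, ε ≤ (V n).gradVariance)
    (hN : Filter.Tendsto (fun n => (V n).numQubits) Filter.atTop Filter.atTop) :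
    ¬ HasBarrenPlateau V := by
  rintro ⟨b, hb, hO⟩
  have h0 : Filter.Tendsto (fun n => (b ^ (V n).numQubits)⁻¹) Filter.atTop (nhds 0) :=
    ((tendsto_pow_atTop_atTop_of_one_lt hb).comp hN).inv_tendsto_atTop
  have h1 := hO.trans_tendsto h0
  exact absurd (ge_of_tendsto' h1 h) (not_le.mpr hε)

/-- The lower bound on the variance of the cost derivative and, as a consequence, the absence of
barren plateaus for sequences of circuits of bounded local depth. -/
theorem theorem2 :
    (∀ V : VQE, V.Assumptions →
      (4 : ℝ) ^ (-((V.interactionRange * V.maxLocalDepth * V.maxBlockSize : ℕ) : ℤ)) *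
          ∑ h ∈ V.relevantTerms, 2 * V.coeff h ^ 2 ≤ V.gradVariance) ∧
    (∀ (V : ℕ → VQE) (r χ β : ℕ) (c : ℝ), 0 < c →
      (∀ n, (V n).Assumptions) →
      Filter.Tendsto (fun n => (V n).numQubits) Filter.atTop Filter.atTop →
      (∀ n, (V n).interactionRange ≤ r) →
      (∀ n, (V n).maxLocalDepth ≤ χ) →
      (∀ n, (V n).maxBlockSize ≤ β) →
      (∀ n, c ≤ ∑ h ∈ (V n).relevantTerms, (V n).coeff h ^ 2) →
      (∀ n, (4 : ℝ) ^ (-((r * χ * β : ℕ) : ℤ)) * (2 * c) ≤ (V n).gradVariance) ∧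
        ¬ HasBarrenPlateau V) := by
  refine ⟨fun V hV => hV.le_gradVariance, fun V r χ β c hc hV hN hr hχ hβ hl => ?_⟩
  have hle : ∀ n, (4 : ℝ) ^ (-((r * χ * β : ℕ) : ℤ)) * (2 * c) ≤ (V n).gradVariance := fun n => by
    refine le_trans ?_ (hV n).le_gradVariance
    rw [← Finset.mul_sum]
    refine mul_le_mul ?_ (mul_le_mul_of_nonneg_left (hl n) zero_le_two) (by positivity)
      (by positivity)
    exact zpow_le_zpow_right₀ (by norm_num) (neg_le_neg (by
      exact_mod_cast Nat.mul_le_mul (Nat.mul_le_mul (hr n) (hχ n)) (hβ n)))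
  exact ⟨hle, not_hasBarrenPlateau_of_le (by positivity) hle hN⟩
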